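/- A hypergraph $G$ consists of a nonempty vertex set $V(G)$ and a set $E(G)$ of nonempty subsets of $V(G)$, called edges; it is $k$-uniform if every edge has exactly $k$ elements. A walk of length $p$ is a sequence $(v_0,e_1,v_1,\dots,e_p,v_p)$ of vertices and edges with $v_{i-1},v_i\in e_i$ and $v_{i-1}\neq v_i$ for $1\le i\le p$. It is a path if all $v_i$ are distinct and all $e_i$ are distinct; it is a cycle if $p\ge 2$, all $e_i$ are distinct, and all $v_i$ are distinct except that $v_0=v_p$. A hypertree is a hypergraph without cycles in which any two vertices are joined by a path. The distance $d_G(u,v)$ is the length of a shortest path from $u$ to $v$, and the distance spectral radius $\rho(G)$ of a finite connected hypergraph $G$ is the largest eigenvalue of its distance matrix $(d_G(u,v))_{u,v\in V(G)}$. Let $k\ge 2$ and $n$ be integers with $\frac{n-1}{k-1}\ge 1$, and let $T$ be a $k$-uniform hypertree on $n$ vertices (so that $m=\frac{n-1}{k-1}$ is an integer). Let $P_{n,k}$ be the $k$-uniform loose path, with vertices $v_1,\dots,v_n$ and edges $e_i=\{v_{(i-1)(k-1)+1},\dots,v_{(i-1)(k-1)+k}\}$ for $i=1,\dots,m$. Then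 $P_{n,k}$ is a $k$-uniform hypertree, and $$\rho(T)\le\rho(P_{n,k}),$$ with equality if and only if $T$ is isomorphic to $P_{n,k}$. -/

import Mathlib

namespace Hypergraph

/-- A hypergraph is `k`-uniform if every edge has exactly `k` vertices. -/
def IsUniform {α : Type*} (G : Hypergraph α) (k : ℕ) : Prop :=
  ∀ e ∈ G.edgeSet, e.ncard = k

/-- `(v 0, e 0, v 1, e 1, …, e (p - 1), v p)` is a walk of length `p` in `G`: the `v i` are
vertices, the `e i` are edges, and `e i` contains the two distinct vertices `v i`, `v (i + 1)`. -/
structure IsWalk {α : Type*} (G : Hypergraph α) (p : ℕ) (v : Fin (p + 1) → α)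
    (e : Fin p → Set α) : Prop where
  mem_vertexSet : ∀ i, v i ∈ G.vertexSet
  mem_edgeSet : ∀ i, e i ∈ G.edgeSet
  left_mem : ∀ i : Fin p, v i.castSucc ∈ e i
  right_mem : ∀ i : Fin p, v i.succ ∈ e i
  ne : ∀ i : Fin p, v i.castSucc ≠ v i.succ

/-- A path is a walk whose vertices are pairwise distinct and whose edges are pairwise distinct. -/
structure IsPath {α : Type*} (G : Hypergraph α) (p : ℕ) (v : Fin (p + 1) → α)
    (e : Fin p → Set α) : Prop where
  isWalk : G.IsWalk p v e
  vertex_injective : Function.Injective v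
  edge_injective : Function.Injective e

/-- A cycle is a walk with at least two edges, with pairwise distinct edges, and with pairwise
distinct vertices except that the first and the last vertex coincide. -/
structure IsCycle {α : Type*} (G : Hypergraph α) (p : ℕ) (v : Fin (p + 1) → α)
    (e : Fin p → Set α) : Prop where
  isWalk : G.IsWalk p v e
  two_le : 2 ≤ p
  edge_injective : Function.Injective e
  vertex_injective : Function.Injective fun i : Fin p => v i.castSucc
  closed : v 0 = v (Fin.last p)

/-- There is a path of length `p` from `u` to `w` in `G`. -/
def HasPath {α : Type*} (G : Hypergraph α) (u w : α) (p : ℕ) : Prop :=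
  ∃ (v : Fin (p + 1) → α) (e : Fin p → Set α), G.IsPath p v e ∧ v 0 = u ∧ v (Fin.last p) = w

/-- A hypertree is a connected hypergraph (with nonempty vertex set) that has no cycles. -/
structure IsHypertree {α : Type*} (G : Hypergraph α) : Prop where
  nonempty : G.vertexSet.Nonempty
  connected : ∀ u ∈ G.vertexSet, ∀ w ∈ G.vertexSet, ∃ p, G.HasPath u w p
  acyclic : ∀ (p : ℕ) (v : Fin (p + 1) → α) (e : Fin p → Set α), ¬ G.IsCycle p v e

/-- The distance between two vertices: the length of a shortest path between them
(`0` by convention if there is none). -/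
noncomputable def dist {α : Type*} (G : Hypergraph α) (u w : α) : ℕ :=
  sInf {p | G.HasPath u w p}

/-- The distance matrix, indexed by the vertices of `G`. -/
noncomputable def distMatrix {α : Type*} (G : Hypergraph α) :
    Matrix G.vertexSet G.vertexSet ℝ :=
  Matrix.of fun u w => (G.dist u w : ℝ)

/-- The distance spectral radius: the largest eigenvalue of the distance matrix
(see `isGreatest_distSpectralRadius`). -/
noncomputable def distSpectralRadius {α : Type*} (G : Hypergraph α) [Fintype G.vertexSet] : ℝ :=
  sSup {μ : ℝ | Module.End.HasEigenvalue G.distMatrix.mulVecLin μ}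

/-- Two hypergraphs are isomorphic if there is a bijection between their vertex sets that maps
edges to edges in both directions. -/
def Isomorphic {α β : Type*} (G : Hypergraph α) (H : Hypergraph β) : Prop :=
  ∃ φ : G.vertexSet ≃ H.vertexSet, ∀ s : Set G.vertexSet,
    Subtype.val '' s ∈ G.edgeSet ↔ Subtype.val '' (φ '' s) ∈ H.edgeSet

/-- The `k`-uniform loose path on the `n` vertices `0, …, n - 1` (where `k - 1` divides `n - 1`):
its `(n - 1) / (k - 1)` edges are the blocks
`{i (k - 1), i (k - 1) + 1, …, i (k - 1) + (k - 1)}` of `k` consecutive vertices. -/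
def loosePath (n k : ℕ) : Hypergraph (Fin n) where
  vertexSet := Set.univ
  edgeSet := {e | ∃ i < (n - 1) / (k - 1),
    e = {j : Fin n | i * (k - 1) ≤ (j : ℕ) ∧ (j : ℕ) ≤ i * (k - 1) + (k - 1)}}
  subset_vertexSet_of_mem_edgeSet' := fun _ _ => Set.subset_univ _

instance (n k : ℕ) : Fintype (loosePath n k).vertexSet :=
  inferInstanceAs (Fintype (Set.univ : Set (Fin n)))

theorem HasPath.symm {α : Type*} {G : Hypergraph α} {u w : α} {p : ℕ} (h : G.HasPath u w p) :
    G.HasPath w u p := by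
  obtain ⟨v, e, h, rfl, rfl⟩ := h
  refine ⟨v ∘ Fin.rev, e ∘ Fin.rev, ⟨⟨fun i => h.isWalk.mem_vertexSet _,
    fun i => h.isWalk.mem_edgeSet _, fun i => ?_, fun i => ?_, fun i => ?_⟩,
    h.vertex_injective.comp Fin.rev_injective, h.edge_injective.comp Fin.rev_injective⟩, ?_, ?_⟩
  · simpa [Fin.rev_castSucc] using h.isWalk.right_mem i.rev
  · simpa [Fin.rev_succ] using h.isWalk.left_mem i.rev
  · simpa [Fin.rev_succ, Fin.rev_castSucc] using (h.isWalk.ne i.rev).symm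
  · simp
  · simp

theorem dist_comm {α : Type*} (G : Hypergraph α) (u w : α) : G.dist u w = G.dist w u := by
  unfold dist
  congr 1
  ext p
  exact ⟨HasPath.symm, HasPath.symm⟩

/-- The supremum in the definition of the distance spectral radius is attained. -/
theorem isGreatest_distSpectralRadius {α : Type*} (G : Hypergraph α) [Fintype G.vertexSet]
    (hG : G.vertexSet.Nonempty) :
    IsGreatest {μ : ℝ | Module.End.HasEigenvalue G.distMatrix.mulVecLin μ}
      G.distSpectralRadius := by
  classical
  have hfin : {μ : ℝ | Module.End.HasEigenvalue G.distMatrix.mulVecLin μ}.Finite :=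
    Module.End.finite_hasEigenvalue _
  have hH : G.distMatrix.IsHermitian := by
    ext u w
    simp [distMatrix, G.dist_comm u w]
  have hne : {μ : ℝ | Module.End.HasEigenvalue G.distMatrix.mulVecLin μ}.Nonempty := by
    refine ⟨hH.eigenvalues ⟨hG.some, hG.some_mem⟩, ?_⟩
    refine Module.End.hasEigenvalue_of_hasEigenvector
      (x := (hH.eigenvectorBasis ⟨hG.some, hG.some_mem⟩).ofLp) ⟨?_, ?_⟩
    · rw [Module.End.mem_eigenspace_iff]
      exact hH.mulVec_eigenvectorBasis _
    · intro h0
      exact hH.eigenvectorBasis.orthonormal.ne_zero _ (by ext i; exact congrFun h0 i)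
  exact ⟨hne.csSup_mem hfin, fun μ hμ => le_csSup hfin.bddAbove hμ⟩

end Hypergraph

/-! Fix positive vertex weights `x` with total `S`. In a hypertree, the distance of two vertices is
the number of edges whose removal separates them. Hence the sum of `x u * x w * d(u, w)` equals `m *
S ^ 2` minus the sum, over all edges `e` and all components left when `e` is removed, of the squared
component weights. For given weights, a large distance sum thus means a small sum of squared branch
weights, which is what `treeCost` and, for a loose path, `pathCost` measure. Both subtract the
squares of all weights, so vertices interior to a path edge drop out and a correction remains only
at the joints `i * K`, the two ends included.

The core is `IsBuilt.exists_label`: the weights of any hypertree can be rearranged on a loose path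
without raising the cost, and with a strictly smaller cost unless the hypertree is itself a loose
path. It goes by induction on pendant edges. Removing a pendant edge at `v` with leaf weight `b`
changes the cost by an explicit amount once `b` is added to the weight of `v` (`treeCost_pendant`).
By induction the rest is at least as costly as a loose path; take a cheapest labelling of that path
and hang the pendant edge back at `v`. If `v` can be taken as an end, the result is a loose path. If
`v` is an inner joint, moving the pendant edge to the end on the lighter side is strictly cheaper
(`pathCost_append_lt`). If `v` is interior to a middle edge, the pendant edge is inserted into the
path next to `v` (`pathCost_insert_lt`). This is strictly cheaper because optimality makes `v` no
heavier than either side of the path (`pathCost_swap_lt`).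

The spectral statement follows from Rayleigh quotients. A positive vector `x` attains the maximum
for `T` (`exists_pos_weightedDist_eq`); its rearrangement on the loose path has the same norm and no
smaller distance sum, so it bounds the spectral radius of the path from below. Longest paths in
acyclic hypergraphs supply the pendant edges (`exists_pendant_edge`). -/

namespace Hypergraph

open Finset

/-! ### Cost of a weighted loose path: recursion and symmetries -/

/-- The arrangement-dependent part of the weighted distance sum of the loose path with `m` edges
of `K + 1` vertices whose vertices carry the weights `y 0, …, y (m * K)`. -/
noncomputable def pathCost (K m : ℕ) (y : ℕ → ℝ) : ℝ :=
  ∑ i ∈ range m, ((∑ p ∈ range (i * K + 1), y p) ^ 2 +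
    (∑ p ∈ range (m * K + 1), y p - ∑ p ∈ range (i * K + K), y p) ^ 2) -
    ∑ i ∈ range (m + 1), y (i * K) ^ 2

theorem block_le {K i m : ℕ} (h : i < m) : i * K + K ≤ m * K := by
  have := Nat.mul_le_mul_right K (Nat.succ_le_of_lt h)
  rwa [Nat.succ_mul] at this

/-- The cost only depends on the weights of the joints and on the partial sums next to joints. -/
theorem pathCost_congr_sums {K m : ℕ} {y y' : ℕ → ℝ}
    (h1 : ∀ i < m, ∑ p ∈ range (i * K + 1), y p = ∑ p ∈ range (i * K + 1), y' p)
    (h2 : ∀ i < m, ∑ p ∈ range (i * K + K), y p = ∑ p ∈ range (i * K + K), y' p)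
    (h3 : ∑ p ∈ range (m * K + 1), y p = ∑ p ∈ range (m * K + 1), y' p)
    (h4 : ∀ i ≤ m, y (i * K) = y' (i * K)) : pathCost K m y = pathCost K m y' := by
  unfold pathCost
  congr 1
  · refine sum_congr rfl fun i hi => ?_
    rw [h1 i (mem_range.1 hi), h2 i (mem_range.1 hi), h3]
  · refine sum_congr rfl fun i hi => ?_
    rw [h4 i (Nat.lt_succ_iff.1 (mem_range.1 hi))]

theorem pathCost_congr {K m : ℕ} {y y' : ℕ → ℝ} (h : ∀ p < m * K + 1, y p = y' p) :
    pathCost K m y = pathCost K m y' := by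
  have key : ∀ t ≤ m * K + 1, ∑ p ∈ range t, y p = ∑ p ∈ range t, y' p := fun t ht =>
    sum_congr rfl fun p hp => h p ((mem_range.1 hp).trans_le ht)
  refine pathCost_congr_sums (fun i hi => key _ ?_) (fun i hi => key _ ?_) (key _ le_rfl)
    fun i hi => h _ ?_
  · have := Nat.mul_le_mul_right K hi.le
    omega
  · have := block_le (K := K) hi
    omega
  · have := Nat.mul_le_mul_right K hi
    omega

theorem sum_range_update {y : ℕ → ℝ} {j t : ℕ} (b : ℝ) :
    ∑ p ∈ range t, Function.update y j (y j + b) p =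
      ∑ p ∈ range t, y p + if j < t then b else 0 := by
  split_ifs with h
  · rw [sum_update_of_mem (mem_range.2 h), ← add_sum_erase _ y (mem_range.2 h), erase_eq]
    ring
  · rw [add_zero]
    refine sum_congr rfl fun p hp => Function.update_of_ne ?_ _ _
    rintro rfl
    exact h (mem_range.1 hp)

/-- The path case of the pendant-edge recursion: for the first `m` edges the new block of weight `b`
acts as if concentrated at the joint `m * K`. The new edge contributes the square of the old total,
and the remaining terms correct the joint squares. -/
theorem pathCost_succ {K m : ℕ} (hK : 1 ≤ K) (y : ℕ → ℝ) {b : ℝ}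
    (hb : ∑ p ∈ range K, y (m * K + 1 + p) = b) :
    pathCost K (m + 1) y = pathCost K m (Function.update y (m * K) (y (m * K) + b)) +
      (∑ p ∈ range (m * K + 1), y p) ^ 2 + (y (m * K) + b) ^ 2 - y (m * K) ^ 2 := by
  have hT : ∑ p ∈ range ((m + 1) * K + 1), y p = ∑ p ∈ range (m * K + 1), y p + b := by
    rw [show (m + 1) * K + 1 = (m * K + 1) + K by ring, sum_range_add, hb]
  have hlast : ∑ p ∈ range ((m + 1) * K + 1), y p - ∑ p ∈ range (m * K + K), y p =
      y ((m + 1) * K) := by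
    rw [show m * K + K = (m + 1) * K by ring, sum_range_succ]
    ring
  unfold pathCost
  rw [sum_range_succ (n := m), hlast, sum_range_succ (n := m + 1), sum_range_succ (n := m),
    sum_range_succ (n := m) (f := fun i => Function.update y (m * K) (y (m * K) + b) (i * K) ^ 2),
    Function.update_self]
  have e1 : ∀ i ∈ range m, Function.update y (m * K) (y (m * K) + b) (i * K) ^ 2 =
      y (i * K) ^ 2 := by
    intro i hi
    rw [Function.update_of_ne]
    have := block_le (K := K) (mem_range.1 hi)
    omega
  have e2 : ∀ i ∈ range m,
      ((∑ p ∈ range (i * K + 1), Function.update y (m * K) (y (m * K) + b) p) ^ 2 +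
      (∑ p ∈ range (m * K + 1), Function.update y (m * K) (y (m * K) + b) p -
        ∑ p ∈ range (i * K + K), Function.update y (m * K) (y (m * K) + b) p) ^ 2) =
      (∑ p ∈ range (i * K + 1), y p) ^ 2 +
      (∑ p ∈ range ((m + 1) * K + 1), y p - ∑ p ∈ range (i * K + K), y p) ^ 2 := by
    intro i hi
    have := block_le (K := K) (mem_range.1 hi)
    rw [sum_range_update, sum_range_update, sum_range_update, hT, if_neg (by omega),
      if_pos (by omega), if_neg (by omega)]
    ring
  rw [sum_congr rfl e1, sum_congr rfl e2]
  ring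

theorem sum_range_reflected {N t : ℕ} (y : ℕ → ℝ) (ht : t ≤ N + 1) :
    ∑ p ∈ range t, y (N - p) = ∑ p ∈ range (N + 1), y p - ∑ p ∈ range (N + 1 - t), y p := by
  induction t with
  | zero => simp
  | succ t ih =>
    rw [sum_range_succ, ih (by omega), show N + 1 - t = (N - t) + 1 by omega,
      sum_range_succ (n := N - t), show N + 1 - (t + 1) = N - t by omega]
    ring

/-- Reversal exchanges the left and right branch weights of mirrored edges. It lets every later
argument assume which side of the path is the lighter one. -/
theorem pathCost_reflect {K m : ℕ} (hK : 1 ≤ K) (y : ℕ → ℝ) :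
    pathCost K m (fun p => y (m * K - p)) = pathCost K m y := by
  have hT : ∑ p ∈ range (m * K + 1), y (m * K - p) = ∑ p ∈ range (m * K + 1), y p := by
    rw [sum_range_reflected _ le_rfl]
    simp
  unfold pathCost
  rw [hT]
  congr 1
  · rw [← sum_range_reflect]
    refine sum_congr rfl fun i hi => ?_
    obtain ⟨d, rfl⟩ : ∃ d, m = i + d + 1 :=
      ⟨m - 1 - i, by have := mem_range.1 hi; omega⟩
    have h1 : (i + d + 1 - 1 - i) = d := by omega
    have h2 : (i + d + 1) * K = i * K + d * K + K := by ring
    rw [h1, h2, sum_range_reflected _ (by omega), sum_range_reflected _ (by omega),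
      show i * K + d * K + K + 1 - (d * K + 1) = i * K + K by omega,
      show i * K + d * K + K + 1 - (d * K + K) = i * K + 1 by omega]
    ring
  · rw [← sum_range_reflect]
    refine sum_congr rfl fun i hi => ?_
    have := mem_range.1 hi
    have h := Nat.mul_le_mul_right K (Nat.lt_succ_iff.1 this)
    simp only [show m + 1 - 1 - i = m - i by omega, Nat.sub_mul, Nat.sub_sub_self h]

theorem sum_range_swap {y : ℕ → ℝ} {p q t : ℕ} (h : (p < t ∧ q < t) ∨ (t ≤ p ∧ t ≤ q)) :
    ∑ s ∈ range t, y (Equiv.swap p q s) = ∑ s ∈ range t, y s := by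
  rcases h with ⟨hp, hq⟩ | ⟨hp, hq⟩
  · refine sum_equiv (Equiv.swap p q) (fun s => ?_) fun _ _ => rfl
    simp only [mem_range]
    rw [Equiv.swap_apply_def]
    split_ifs <;> omega
  · refine sum_congr rfl fun s hs => ?_
    have := mem_range.1 hs
    rw [Equiv.swap_apply_of_ne_of_ne] <;> omega

theorem sum_range_swap_of_between {y : ℕ → ℝ} {p q t : ℕ} (hp : p < t) (hq : t ≤ q) :
    ∑ s ∈ range t, y (Equiv.swap p q s) = ∑ s ∈ range t, y s + (y q - y p) := by
  have := sum_range_update (y := y) (j := p) (t := t) (y q - y p)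
  rw [if_pos hp] at this
  rw [← this]
  refine sum_congr rfl fun s hs => ?_
  have := mem_range.1 hs
  rw [Function.update_apply]
  split_ifs with h
  · subst h
    rw [Equiv.swap_apply_left]
    ring
  · rw [Equiv.swap_apply_of_ne_of_ne h (by omega)]

theorem mul_lt_or {K i j : ℕ} : i * K + K ≤ j * K ∨ i = j ∨ j * K + K ≤ i * K := by
  rcases lt_trichotomy i j with h | h | h
  · exact Or.inl (block_le h)
  · exact Or.inr (Or.inl h)
  · exact Or.inr (Or.inr (block_le h))

/-- Exchanging two interior vertices of an edge does not change the cost. -/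
theorem pathCost_swap_interior {K m i p q : ℕ} (y : ℕ → ℝ) (hi : i < m)
    (hp : i * K < p) (hp' : p < i * K + K) (hq : i * K < q) (hq' : q < i * K + K) :
    pathCost K m (y ∘ Equiv.swap p q) = pathCost K m y := by
  have hm := block_le (K := K) hi
  refine pathCost_congr_sums (fun j hj => sum_range_swap ?_) (fun j hj => sum_range_swap ?_)
    (sum_range_swap ?_) fun j hj => ?_
  · rcases mul_lt_or (K := K) (i := i) (j := j) with h | h | h <;> [skip; subst h; skip] <;> omega
  · rcases mul_lt_or (K := K) (i := i) (j := j) with h | h | h <;> [skip; subst h; skip] <;> omega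
  · omega
  · rw [Function.comp, Equiv.swap_apply_of_ne_of_ne] <;>
    rcases mul_lt_or (K := K) (i := i) (j := j) with h | h | h <;>
      [skip; subst h; skip; skip; subst h; skip] <;> omega

/-- Exchanging two vertices of the last edge, other than its joint, does not change the cost. -/
theorem pathCost_swap_last {K m j : ℕ} (y : ℕ → ℝ) (hj : m * K < j)
    (hj' : j < m * K + K) :
    pathCost K (m + 1) (y ∘ Equiv.swap j ((m + 1) * K)) = pathCost K (m + 1) y := by
  have e : (m + 1) * K = m * K + K := by ring
  have hT : ∑ p ∈ range (m * K + K + 1), y (Equiv.swap j (m * K + K) p) =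
      ∑ p ∈ range (m * K + K + 1), y p := sum_range_swap (by omega)
  unfold pathCost
  simp only [Function.comp, e]
  rw [hT, sum_range_succ, sum_range_succ (n := m), sum_range_succ (n := m + 1),
    sum_range_succ (n := m + 1), e, Equiv.swap_apply_right,
    sum_range_swap (t := m * K + 1) (by omega),
    sum_range_swap_of_between (t := m * K + K) (by omega) (by omega),
    sum_range_succ (n := m * K + K)]
  have h1 : ∀ i ∈ range m, ((∑ p ∈ range (i * K + 1), y (Equiv.swap j (m * K + K) p)) ^ 2 +
      (∑ p ∈ range (m * K + K), y p + y (m * K + K) -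
        ∑ p ∈ range (i * K + K), y (Equiv.swap j (m * K + K) p)) ^ 2) =
      ((∑ p ∈ range (i * K + 1), y p) ^ 2 +
      (∑ p ∈ range (m * K + K), y p + y (m * K + K) - ∑ p ∈ range (i * K + K), y p) ^ 2) := by
    intro i hi
    have := block_le (K := K) (mem_range.1 hi)
    rw [sum_range_swap (by omega), sum_range_swap (by omega)]
  have h2 : ∀ i ∈ range (m + 1), y (Equiv.swap j (m * K + K) (i * K)) ^ 2 = y (i * K) ^ 2 := by
    intro i hi
    have := Nat.mul_le_mul_right K (Nat.lt_succ_iff.1 (mem_range.1 hi))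
    rw [Equiv.swap_apply_of_ne_of_ne] <;> omega
  rw [sum_congr rfl h1, sum_congr rfl h2]
  ring

/-! ### Rearrangements that lower the path cost -/

/-- If an interior vertex of an edge is heavier than everything to the left of that edge, and that
left part is not heavier than the right part, exchanging it with an interior vertex of the previous
edge decreases the cost. -/
theorem pathCost_swap_lt {K m i j : ℕ} {y : ℕ → ℝ} (hy : ∀ p < m * K + 1, 0 < y p)
    (hi : i + 1 < m) (hj : (i + 1) * K < j) (hj' : j < (i + 1) * K + K)
    (hL : ∑ p ∈ range ((i + 1) * K + 1), y p < y j)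
    (hLR : ∑ p ∈ range ((i + 1) * K + 1), y p ≤
      ∑ p ∈ range (m * K + 1), y p - ∑ p ∈ range ((i + 1) * K + K), y p) :
    pathCost K m (y ∘ Equiv.swap (j - K) j) < pathCost K m y := by
  have e : (i + 1) * K = i * K + K := by ring
  have hm := block_le (K := K) hi
  have mono : ∀ s t, s ≤ t → t ≤ m * K + 1 → ∑ p ∈ range s, y p ≤ ∑ p ∈ range t, y p :=
    fun s t hst ht => sum_le_sum_of_subset_of_nonneg (range_mono hst) fun p hp _ =>
      (hy p ((mem_range.1 hp).trans_le ht)).le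
  have hq : y (j - K) < y j := by
    refine lt_of_le_of_lt ?_ hL
    exact single_le_sum (fun p hp => (hy p (by have := mem_range.1 hp; omega)).le)
      (mem_range.2 (by omega))
  have hq0 := hy (j - K) (by omega)
  have hT : ∑ p ∈ range (m * K + 1), y (Equiv.swap (j - K) j p) =
      ∑ p ∈ range (m * K + 1), y p := sum_range_swap (by omega)
  unfold pathCost
  simp only [Function.comp]
  rw [hT]
  have hJ : ∑ i ∈ range (m + 1), y (Equiv.swap (j - K) j (i * K)) ^ 2 =
      ∑ i ∈ range (m + 1), y (i * K) ^ 2 := by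
    refine sum_congr rfl fun s _ => ?_
    rcases mul_lt_or (K := K) (i := i + 1) (j := s) with h | h | h
    · rw [Equiv.swap_apply_of_ne_of_ne] <;> omega
    · rw [← h, Equiv.swap_apply_of_ne_of_ne] <;> omega
    · rcases mul_lt_or (K := K) (i := i) (j := s) with h' | h' | h'
      · rw [Equiv.swap_apply_of_ne_of_ne] <;> omega
      · rw [← h', Equiv.swap_apply_of_ne_of_ne] <;> omega
      · rw [Equiv.swap_apply_of_ne_of_ne] <;> omega
  rw [hJ]
  refine sub_lt_sub_right ?_ _
  obtain ⟨d, rfl⟩ : ∃ d, m = (i + 2) + d := ⟨m - (i + 2), by omega⟩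
  rw [sum_range_add _ (i + 2) d, sum_range_add _ (i + 2) d, sum_range_succ _ (i + 1),
    sum_range_succ _ i, sum_range_succ _ (i + 1), sum_range_succ _ i]
  set S := ∑ p ∈ range ((i + 2 + d) * K + 1), y p with hS
  have h1 : ∀ s ∈ range i, ((∑ p ∈ range (s * K + 1), y (Equiv.swap (j - K) j p)) ^ 2 +
      (S - ∑ p ∈ range (s * K + K), y (Equiv.swap (j - K) j p)) ^ 2) =
      ((∑ p ∈ range (s * K + 1), y p) ^ 2 + (S - ∑ p ∈ range (s * K + K), y p) ^ 2) := by
    intro s hs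
    have := block_le (K := K) (mem_range.1 hs)
    rw [sum_range_swap (by omega), sum_range_swap (by omega)]
  have h2 : ∀ s ∈ range d,
      ((∑ p ∈ range ((i + 2 + s) * K + 1), y (Equiv.swap (j - K) j p)) ^ 2 +
      (S - ∑ p ∈ range ((i + 2 + s) * K + K), y (Equiv.swap (j - K) j p)) ^ 2) =
      ((∑ p ∈ range ((i + 2 + s) * K + 1), y p) ^ 2 +
        (S - ∑ p ∈ range ((i + 2 + s) * K + K), y p) ^ 2) := by
    intro s hs
    have : (i + 2 + s) * K = i * K + K + K + s * K := by ring
    rw [sum_range_swap (by omega), sum_range_swap (by omega)]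
  rw [sum_congr rfl h1, sum_congr rfl h2, sum_range_swap (t := i * K + 1) (by omega),
    sum_range_swap (t := (i + 1) * K + K) (by omega),
    sum_range_swap_of_between (t := i * K + K) (by omega) (by omega),
    sum_range_swap_of_between (t := (i + 1) * K + 1) (by omega) (by omega)]
  have hA1 : ∑ p ∈ range ((i + 1) * K + 1), y p = ∑ p ∈ range (i * K + K), y p + y (i * K + K) := by
    rw [e, sum_range_succ]
  have hA2 : ∑ p ∈ range ((i + 1) * K + 1), y p + y j ≤ ∑ p ∈ range ((i + 1) * K + K), y p := by
    have h3 : ∑ p ∈ range ((i + 1) * K + 1), y p ≤ ∑ p ∈ range j, y p :=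
      mono _ _ (by omega) (by omega)
    have h4 : ∑ p ∈ range (j + 1), y p ≤ ∑ p ∈ range ((i + 1) * K + K), y p :=
      mono _ _ (by omega) (by omega)
    rw [sum_range_succ] at h4
    linarith
  have hk := hy (i * K + K) (by omega)
  -- Only the right branch of edge `i` and the left branch of edge `i + 1` change. With `δ = y j - y
  -- (j - K)`, the cost changes by at most `-2 * δ * (y (i * K + K) + y (j - K))`.
  nlinarith [mul_pos (sub_pos.2 hq) hq0, mul_pos (sub_pos.2 hq) hk]

/-- Moving a pendant edge from a joint to the right end of the path decreases the cost, if the part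
to the left of the joint is at least as heavy as the part to the right of it. -/
theorem pathCost_append_lt {K m i : ℕ} {y : ℕ → ℝ} {b : ℝ} (hK : 1 ≤ K)
    (hy : ∀ p < m * K + 1, 0 < y p) (hb : 0 < b) (hi : i < m)
    (hLR : ∑ p ∈ range (m * K + 1), y p - ∑ p ∈ range (i * K + 1), y p ≤
      ∑ p ∈ range (i * K), y p) :
    pathCost K m (Function.update y (m * K) (y (m * K) + b)) + (y (m * K) + b) ^ 2 - y (m * K) ^ 2 <
      pathCost K m (Function.update y (i * K) (y (i * K) + b)) +
        (y (i * K) + b) ^ 2 - y (i * K) ^ 2 := by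
  have mono : ∀ s t, s ≤ t → t ≤ m * K + 1 → ∑ p ∈ range s, y p ≤ ∑ p ∈ range t, y p :=
    fun s t hst ht => sum_le_sum_of_subset_of_nonneg (range_mono hst) fun p hp _ =>
      (hy p ((mem_range.1 hp).trans_le ht)).le
  have hJ : ∀ s ≤ m, ∑ i ∈ range (m + 1), Function.update y (s * K) (y (s * K) + b) (i * K) ^ 2 =
      ∑ i ∈ range (m + 1), y (i * K) ^ 2 + ((y (s * K) + b) ^ 2 - y (s * K) ^ 2) := by
    intro s hs
    have hs' : s ∈ range (m + 1) := mem_range.2 (by omega)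
    rw [← add_sum_erase _ _ hs', ← add_sum_erase _ (fun i => y (i * K) ^ 2) hs',
      Function.update_self, sum_congr rfl (g := fun i => y (i * K) ^ 2)]
    · ring
    · intro t ht
      rw [Function.update_of_ne]
      intro h
      exact ne_of_mem_erase ht (Nat.eq_of_mul_eq_mul_right hK h)
  unfold pathCost
  rw [hJ m le_rfl, hJ i hi.le]
  have hmK := block_le (K := K) hi
  simp only [sum_range_update]
  have : ∑ s ∈ range m, ((∑ p ∈ range (s * K + 1), y p + if m * K < s * K + 1 then b else 0) ^ 2 +
      ((∑ p ∈ range (m * K + 1), y p + if m * K < m * K + 1 then b else 0) -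
        (∑ p ∈ range (s * K + K), y p + if m * K < s * K + K then b else 0)) ^ 2) <
      ∑ s ∈ range m, ((∑ p ∈ range (s * K + 1), y p + if i * K < s * K + 1 then b else 0) ^ 2 +
      ((∑ p ∈ range (m * K + 1), y p + if i * K < m * K + 1 then b else 0) -
        (∑ p ∈ range (s * K + K), y p + if i * K < s * K + K then b else 0)) ^ 2) := by
    -- For an edge right of joint `i`, let `l` and `r` be its branch weights without `b`. Moving `b`
    -- from the left branch to the right one saves `2 * b * (l - r)`, and `r < l` by `hLR` and the
    -- positive weight of the joint. Edges left of the joint see `b` on their right in both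
    -- positions.
    have key : ∀ s < m, i ≤ s →
        ((∑ p ∈ range (s * K + 1), y p + if m * K < s * K + 1 then b else 0) ^ 2 +
      ((∑ p ∈ range (m * K + 1), y p + if m * K < m * K + 1 then b else 0) -
        (∑ p ∈ range (s * K + K), y p + if m * K < s * K + K then b else 0)) ^ 2) <
      ((∑ p ∈ range (s * K + 1), y p + if i * K < s * K + 1 then b else 0) ^ 2 +
      ((∑ p ∈ range (m * K + 1), y p + if i * K < m * K + 1 then b else 0) -
        (∑ p ∈ range (s * K + K), y p + if i * K < s * K + K then b else 0)) ^ 2) := by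
      intro s hs his
      have h1 := Nat.mul_le_mul_right K his
      have h2 := block_le (K := K) hs
      rw [if_neg (by omega), if_pos (by omega), if_neg (by omega), if_pos (by omega),
        if_pos (by omega), if_pos (by omega)]
      have h3 := mono (i * K + 1) (s * K + 1) (by omega) (by omega)
      have h4 := mono (i * K + 1) (s * K + K) (by omega) (by omega)
      have h5 : ∑ p ∈ range (i * K + 1), y p = ∑ p ∈ range (i * K), y p + y (i * K) :=
        sum_range_succ _ _
      have h6 := hy (i * K) (by omega)
      nlinarith
    refine sum_lt_sum (fun s hs => ?_) ⟨i, mem_range.2 hi, key i hi le_rfl⟩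
    have hs := mem_range.1 hs
    rcases le_or_gt i s with h | h
    · exact (key s hs h).le
    · have h1 := block_le (K := K) h
      have h2 := block_le (K := K) hs
      rw [if_neg (by omega), if_pos (by omega), if_neg (by omega), if_neg (by omega),
        if_pos (by omega), if_neg (by omega)]
  linarith

/-- A pendant edge at an interior vertex of an edge, which together with that vertex is not heavier
than either side of the path, can be inserted into the path with a decrease of the cost. -/
theorem pathCost_insert_lt {K m i c : ℕ} {y y' z : ℕ → ℝ} {a b : ℝ} (hK : 2 ≤ K)
    (hy : ∀ p < m * K + 1, 0 < y p) (hi : i < m) (hc : c + 1 = i * K + K)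
    (hz : ∀ p < K, 0 < z p) (hb : ∑ p ∈ range K, z p = b) (ha : 0 < a) (hyc : y c = a + b)
    (h1 : ∀ p < c, y' p = y p) (h2 : y' c = z 0) (h3 : y' (c + 1) = a)
    (h4 : ∀ p < K - 1, y' (c + 2 + p) = z (p + 1))
    (h5 : ∀ p, c < p → p ≤ m * K → y' (p + K) = y p)
    (hL : a + b ≤ ∑ p ∈ range (i * K + 1), y p)
    (hR : a + b ≤ ∑ p ∈ range (m * K + 1), y p - ∑ p ∈ range (i * K + K), y p) :
    pathCost K (m + 1) y' < pathCost K m y + (∑ p ∈ range (m * K + 1), y p - b) ^ 2 +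
      (a + b) ^ 2 - a ^ 2 := by
  have hm := block_le (K := K) hi
  have hb' : b = z 0 + ∑ p ∈ range (K - 1), z (p + 1) := by
    rw [← hb, show K = K - 1 + 1 by omega, sum_range_succ', add_comm]
    simp
  have hz0 := hz 0 (by omega)
  have hbz : 0 ≤ ∑ p ∈ range (K - 1), z (p + 1) :=
    sum_nonneg fun p hp => (hz _ (by have := mem_range.1 hp; omega)).le
  have A1 : ∀ t ≤ c, ∑ p ∈ range t, y' p = ∑ p ∈ range t, y p := fun t ht =>
    sum_congr rfl fun p hp => h1 p ((mem_range.1 hp).trans_le ht)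
  have A2 : ∑ p ∈ range (c + 1), y' p = ∑ p ∈ range c, y p + z 0 := by
    rw [sum_range_succ, A1 c le_rfl, h2]
  have A3 : ∑ p ∈ range (c + 2), y' p = ∑ p ∈ range c, y p + z 0 + a := by
    rw [sum_range_succ, A2, h3]
  have A4 : ∀ s, c + 1 + s ≤ m * K + 1 →
      ∑ p ∈ range (c + 1 + K + s), y' p = ∑ p ∈ range (c + 1 + s), y p := by
    intro s hs
    rw [sum_range_add _ (c + 1 + K) s, sum_range_add _ (c + 1) s,
      show c + 1 + K = c + 2 + (K - 1) by omega, sum_range_add _ (c + 2) (K - 1), A3,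
      sum_congr rfl (g := fun p => z (p + 1)) fun p hp => h4 p (mem_range.1 hp),
      sum_range_succ, hyc,
      hb']
    have : ∑ x ∈ range s, y' (c + 2 + (K - 1) + x) = ∑ x ∈ range s, y (c + 1 + x) := by
      refine sum_congr rfl fun x hx => ?_
      have := mem_range.1 hx
      rw [← h5 (c + 1 + x) (by omega) (by omega)]
      congr 1
      omega
    rw [this]
    ring
  have e : (m + 1) * K = m * K + K := by ring
  have AT : ∑ p ∈ range ((m + 1) * K + 1), y' p = ∑ p ∈ range (m * K + 1), y p := by
    have := A4 (m * K - c) (by omega)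
    rwa [show c + 1 + K + (m * K - c) = (m + 1) * K + 1 by omega,
      show c + 1 + (m * K - c) = m * K + 1 by omega] at this
  obtain ⟨d, rfl⟩ : ∃ d, m = i + 1 + d := ⟨m - (i + 1), by omega⟩
  have hJ : ∑ s ∈ range (i + 1 + d + 1 + 1), y' (s * K) ^ 2 =
      ∑ s ∈ range (i + 1 + d + 1), y (s * K) ^ 2 + a ^ 2 := by
    rw [show i + 1 + d + 1 + 1 = (i + 1 + 1) + (d + 1) by ring, sum_range_add _ (i + 1 + 1) (d + 1),
      show i + 1 + d + 1 = (i + 1) + (d + 1) by ring, sum_range_add _ (i + 1) (d + 1),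
      sum_range_succ _ (i + 1),
      show (i + 1) * K = c + 1 by rw [hc]; ring, h3]
    have j1 : ∑ s ∈ range (i + 1), y' (s * K) ^ 2 = ∑ s ∈ range (i + 1), y (s * K) ^ 2 := by
      refine sum_congr rfl fun s hs => ?_
      have := Nat.mul_le_mul_right K (Nat.lt_succ_iff.1 (mem_range.1 hs))
      rw [h1 _ (by omega)]
    have j2 : ∑ s ∈ range (d + 1), y' ((i + 1 + 1 + s) * K) ^ 2 =
        ∑ s ∈ range (d + 1), y ((i + 1 + s) * K) ^ 2 := by
      refine sum_congr rfl fun s hs => ?_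
      have h6 := Nat.mul_le_mul_right K (Nat.lt_succ_iff.1 (mem_range.1 hs))
      have h7 : (i + 1 + s) * K = i * K + K + s * K := by ring
      have h8 : (i + 1 + d) * K = i * K + K + d * K := by ring
      rw [← h5 ((i + 1 + s) * K) (by omega) (by omega)]
      congr 2
      ring
    rw [j1, j2]
    ring
  unfold pathCost
  rw [hJ, AT]
  set S := ∑ p ∈ range ((i + 1 + d) * K + 1), y p with hS
  rw [show i + 1 + d + 1 = (i + 1 + 1) + d by ring, sum_range_add _ (i + 1 + 1) d,
    sum_range_add (fun s => (∑ p ∈ range (s * K + 1), y p) ^ 2 + _) (i + 1) d,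
    sum_range_succ _ (i + 1), sum_range_succ _ i, sum_range_succ _ i]
  have g1 : ∀ s ∈ range i, ((∑ p ∈ range (s * K + 1), y' p) ^ 2 +
      (S - ∑ p ∈ range (s * K + K), y' p) ^ 2) =
      ((∑ p ∈ range (s * K + 1), y p) ^ 2 + (S - ∑ p ∈ range (s * K + K), y p) ^ 2) := by
    intro s hs
    have := block_le (K := K) (mem_range.1 hs)
    rw [A1 _ (by omega), A1 _ (by omega)]
  have g2 : ∀ s ∈ range d, ((∑ p ∈ range ((i + 1 + 1 + s) * K + 1), y' p) ^ 2 +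
      (S - ∑ p ∈ range ((i + 1 + 1 + s) * K + K), y' p) ^ 2) =
      ((∑ p ∈ range ((i + 1 + s) * K + 1), y p) ^ 2 +
        (S - ∑ p ∈ range ((i + 1 + s) * K + K), y p) ^ 2) := by
    intro s hs
    have h6 := block_le (K := K) (mem_range.1 hs)
    have h7 : (i + 1 + s) * K = i * K + K + s * K := by ring
    have h8 : (i + 1 + d) * K = i * K + K + d * K := by ring
    have h9 : (i + 1 + 1 + s) * K = i * K + K + K + s * K := by ring
    rw [show (i + 1 + 1 + s) * K + 1 = c + 1 + K + (s * K + 1) by omega,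
      show (i + 1 + 1 + s) * K + K = c + 1 + K + (s * K + K) by omega,
      A4 _ (by omega), A4 _ (by omega),
      show c + 1 + (s * K + 1) = (i + 1 + s) * K + 1 by omega,
      show c + 1 + (s * K + K) = (i + 1 + s) * K + K by omega]
  have e2 : (i + 1) * K = c + 1 := by rw [hc]; ring
  have A5 := A4 0 (by omega)
  rw [add_zero, add_zero] at A5
  rw [sum_congr rfl g1, sum_congr rfl g2, A1 _ (by omega), e2, A3, A5, ← hc, A2]
  rw [← hc] at hR
  have hAc : ∑ p ∈ range (c + 1), y p = ∑ p ∈ range c, y p + (a + b) := by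
    rw [sum_range_succ, hyc]
  have hLc : ∑ p ∈ range (i * K + 1), y p ≤ ∑ p ∈ range c, y p :=
    sum_le_sum_of_subset_of_nonneg (range_mono (by omega)) fun p hp _ =>
      (hy p (by have := mem_range.1 hp; omega)).le
  rw [hAc] at hR ⊢
  set B := ∑ p ∈ range c, y p
  -- What remains is `(S - B - z 0) ^ 2 + (B + z 0 + a) ^ 2 < (S - b) ^ 2 + (a + b) ^ 2`. Both pairs
  -- of bases have sum `S + a`, and the gap is twice the product of `p1` and `p2`, the amounts by
  -- which `S - b` exceeds the two bases on the left.
  have p1 : 0 < S - (B + (a + b)) - z 0 := by linarith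
  have p2 : 0 < B - b + z 0 := by linarith
  nlinarith [mul_pos p1 p2]

/-! ### Pendant edges and distance functions -/

/-- `G` arises from `G₁` by attaching a pendant edge with new vertices `L` at the vertex `v`. -/
structure IsPendant {α : Type*} (G₁ G : Hypergraph α) (v : α) (L : Finset α) : Prop where
  mem : v ∈ G₁.vertexSet
  notMem : ∀ u ∈ L, u ∉ G₁.vertexSet
  vertexSet_eq : G.vertexSet = G₁.vertexSet ∪ ↑L
  edgeSet_eq : G.edgeSet = insert (insert v ↑L) G₁.edgeSet

/-- Hypergraphs obtained from a single vertex by attaching `m` pendant edges of `K + 1` vertices. -/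
inductive IsBuilt {α : Type*} (K : ℕ) : ℕ → Hypergraph α → Prop
  | single (G : Hypergraph α) (v : α) (hV : G.vertexSet = {v}) (hE : G.edgeSet = ∅) : IsBuilt K 0 G
  | pendant (m : ℕ) (G₁ G : Hypergraph α) (v : α) (L : Finset α) (h₁ : IsBuilt K m G₁)
      (h : IsPendant G₁ G v L) (hL : L.card = K) : IsBuilt K (m + 1) G

/-- A function that behaves like the distance function of a connected hypergraph. -/
structure IsDistFun {α : Type*} (G : Hypergraph α) (d : α → α → ℕ) : Prop where
  self : ∀ u ∈ G.vertexSet, d u u = 0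
  lip : ∀ u ∈ G.vertexSet, ∀ e ∈ G.edgeSet, ∀ a ∈ e, ∀ b ∈ e, d u a ≤ d u b + 1
  descent : ∀ u ∈ G.vertexSet, ∀ w ∈ G.vertexSet, u ≠ w →
    ∃ e ∈ G.edgeSet, ∃ a ∈ e, w ∈ e ∧ d u w = d u a + 1

section
variable {α : Type*} {G : Hypergraph α} {d : α → α → ℕ}

theorem IsDistFun.exists_seq (h : IsDistFun G d) {u : α} (hu : u ∈ G.vertexSet) (n : ℕ) :
    ∀ w ∈ G.vertexSet, d u w = n → ∃ (v : ℕ → α) (e : ℕ → Set α), v 0 = u ∧ v n = w ∧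
      (∀ i ≤ n, v i ∈ G.vertexSet ∧ d u (v i) = i) ∧
      ∀ i < n, e i ∈ G.edgeSet ∧ v i ∈ e i ∧ v (i + 1) ∈ e i := by
  induction n with
  | zero =>
    intro w hw hd
    have : u = w := by
      by_contra hne
      obtain ⟨e, -, a, -, -, h'⟩ := h.descent u hu w hw hne
      omega
    subst this
    exact ⟨fun _ => u, fun _ => ∅, rfl, rfl, fun i hi => ⟨hu, by rw [hd]; omega⟩, by simp⟩
  | succ n ih =>
    intro w hw hd
    have hne : u ≠ w := by
      rintro rfl
      rw [h.self u hu] at hd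
      omega
    obtain ⟨e, he, a, ha, hwe, h'⟩ := h.descent u hu w hw hne
    obtain ⟨v, E, h0, hn, h1, h2⟩ := ih a (mem_vertexSet_of_mem_edgeSet he ha) (by omega)
    refine ⟨fun i => if i ≤ n then v i else w, fun i => if i < n then E i else e, by simp [h0],
      by simp, fun i hi => ?_, fun i hi => ?_⟩
    · by_cases hin : i ≤ n
      · simpa [hin] using h1 i hin
      · have : i = n + 1 := by omega
        subst this
        simpa using ⟨hw, hd⟩
    · by_cases hin : i < n
      · simpa [hin, hin.le, Nat.succ_le_of_lt hin] using h2 i hin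
      · have : i = n := by omega
        subst this
        simpa [hn] using ⟨he, ha, hwe⟩

/-- Following the descent back to `u` gives vertices at distances 0, 1, 2, and so on. They are
therefore distinct, and the Lipschitz property keeps two steps from using the same edge. -/
theorem IsDistFun.hasPath (h : IsDistFun G d) {u w : α} (hu : u ∈ G.vertexSet)
    (hw : w ∈ G.vertexSet) : G.HasPath u w (d u w) := by
  obtain ⟨v, e, h0, hn, h1, h2⟩ := h.exists_seq hu _ w hw rfl
  have hd : ∀ i : Fin (d u w + 1), d u (v i) = i := fun i => (h1 i (by omega)).2
  refine ⟨fun i => v i, fun i => e i, ⟨⟨fun i => (h1 i (by omega)).1, fun i => (h2 i i.2).1,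
    fun i => (h2 i i.2).2.1, fun i => (h2 i i.2).2.2, fun i hi => ?_⟩, fun i j hij => ?_,
    fun i j hij => ?_⟩, h0, hn⟩
  · have := hd i.castSucc
    rw [hi, hd] at this
    simp at this
  · ext
    rw [← hd i, ← hd j]
    exact congrArg _ hij
  · have key : ∀ i j : Fin (d u w), e i = e j → (j : ℕ) ≤ i := by
      intro i j hij
      have h3 := h.lip u hu (e i) (h2 i i.2).1 (v (j + 1)) (hij ▸ (h2 j j.2).2.2) (v i)
        (h2 i i.2).2.1
      rw [(h1 (j + 1) (by omega)).2, (h1 i (by omega)).2] at h3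
      omega
    exact Fin.ext (le_antisymm (key j i hij.symm) (key i j hij))

/-- The three axioms determine the distance: descent produces a path of length `d u w`, and the
Lipschitz property makes every path at least that long. Distances can thus be computed by guessing a
formula and checking the axioms. -/
theorem IsDistFun.dist_eq (h : IsDistFun G d) {u w : α} (hu : u ∈ G.vertexSet)
    (hw : w ∈ G.vertexSet) : G.dist u w = d u w := by
  refine le_antisymm (Nat.sInf_le (h.hasPath hu hw)) (le_csInf ⟨_, h.hasPath hu hw⟩ ?_)
  rintro p ⟨v, e, hp, rfl, rfl⟩
  have : ∀ i : Fin (p + 1), d (v 0) (v i) ≤ i := by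
    intro i
    induction i using Fin.induction with
    | zero => simp [h.self _ hu]
    | succ i ih =>
      have := h.lip _ hu (e i) (hp.isWalk.mem_edgeSet i) _ (hp.isWalk.right_mem i) _
        (hp.isWalk.left_mem i)
      simp only [Fin.val_succ, Fin.val_castSucc] at ih ⊢
      omega
  simpa using this (Fin.last p)

theorem IsDistFun.dist (h : IsDistFun G d) : IsDistFun G G.dist where
  self u hu := by rw [h.dist_eq hu hu, h.self u hu]
  lip u hu e he a ha b hb := by
    rw [h.dist_eq hu (mem_vertexSet_of_mem_edgeSet he ha),
      h.dist_eq hu (mem_vertexSet_of_mem_edgeSet he hb)]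
    exact h.lip u hu e he a ha b hb
  descent u hu w hw hne := by
    obtain ⟨e, he, a, ha, hwe, h'⟩ := h.descent u hu w hw hne
    refine ⟨e, he, a, ha, hwe, ?_⟩
    rw [h.dist_eq hu hw, h.dist_eq hu (mem_vertexSet_of_mem_edgeSet he ha), h']

end

section
variable {α : Type*} {G₁ G : Hypergraph α} {v : α} {L : Finset α} {d : α → α → ℕ}

open Classical in
/-- The distance function of a hypergraph with a pendant edge attached. -/
noncomputable def pendantDist {α : Type*} (d : α → α → ℕ) (v : α) (L : Finset α) (u w : α) : ℕ :=
  if u ∈ L then (if w ∈ L then (if u = w then 0 else 1) else d v w + 1)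
  else (if w ∈ L then d u v + 1 else d u w)

theorem IsPendant.isDistFun (hP : IsPendant G₁ G v L) (h : IsDistFun G₁ d) :
    IsDistFun G (pendantDist d v L) := by
  have hv : v ∉ L := fun hv => hP.notMem v hv hP.mem
  have hV : ∀ u ∈ G.vertexSet, u ∉ L → u ∈ G₁.vertexSet := by
    intro u hu huL
    rw [hP.vertexSet_eq] at hu
    exact hu.resolve_right huL
  have hE : ∀ e ∈ G₁.edgeSet, ∀ a ∈ e, a ∉ L := fun e he a ha haL =>
    hP.notMem a haL (mem_vertexSet_of_mem_edgeSet he ha)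
  refine ⟨fun u hu => ?_, fun u hu e he a ha b hb => ?_, fun u hu w hw hne => ?_⟩
  · by_cases huL : u ∈ L
    · simp [pendantDist, huL]
    · simp [pendantDist, huL, h.self u (hV u hu huL)]
  · rw [hP.edgeSet_eq] at he
    rcases he with rfl | he
    · have hvv := h.self v hP.mem
      rcases ha with rfl | ha <;> rcases hb with rfl | hb <;> by_cases huL : u ∈ L <;>
        simp_all [pendantDist] <;> (try split_ifs) <;> omega
    · have haL := hE e he a ha
      have hbL := hE e he b hb
      by_cases huL : u ∈ L
      · simpa [pendantDist, huL, haL, hbL] using h.lip v hP.mem e he a ha b hb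
      · simpa [pendantDist, huL, haL, hbL] using h.lip u (hV u hu huL) e he a ha b hb
  · have hvv := h.self v hP.mem
    rw [hP.edgeSet_eq]
    by_cases huL : u ∈ L <;> by_cases hwL : w ∈ L
    · refine ⟨_, Set.mem_insert _ _, u, Set.mem_insert_of_mem _ huL, Set.mem_insert_of_mem _ hwL,
        ?_⟩
      simp [pendantDist, huL, hwL, hne]
    · by_cases hvw : v = w
      · subst hvw
        refine ⟨_, Set.mem_insert _ _, u, Set.mem_insert_of_mem _ huL, Set.mem_insert _ _, ?_⟩
        simp [pendantDist, huL, hwL, hvv]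
      · obtain ⟨e, he, a, ha, hwe, h'⟩ := h.descent v hP.mem w (hV w hw hwL) hvw
        refine ⟨e, Set.mem_insert_of_mem _ he, a, ha, hwe, ?_⟩
        simp [pendantDist, huL, hwL, hE e he a ha, h']
    · refine ⟨_, Set.mem_insert _ _, v, Set.mem_insert _ _, Set.mem_insert_of_mem _ hwL, ?_⟩
      simp [pendantDist, huL, hwL, hv]
    · obtain ⟨e, he, a, ha, hwe, h'⟩ := h.descent u (hV u hu huL) w (hV w hw hwL) hne
      refine ⟨e, Set.mem_insert_of_mem _ he, a, ha, hwe, ?_⟩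
      simp [pendantDist, huL, hwL, hE e he a ha, h']

theorem IsBuilt.isDistFun {K m : ℕ} (h : IsBuilt K m G) : IsDistFun G G.dist := by
  induction h with
  | single G v hV hE =>
    refine IsDistFun.dist (d := fun _ _ => 0) ⟨by simp, by simp, fun u hu w hw hne => ?_⟩
    rw [hV] at hu hw
    exact absurd (hu.trans hw.symm) hne
  | pendant m G₁ G v L h₁ h hL ih => exact (h.isDistFun ih).dist

theorem IsPendant.dist_eq (hP : IsPendant G₁ G v L) (h : IsDistFun G₁ G₁.dist) {u w : α}
    (hu : u ∈ G.vertexSet) (hw : w ∈ G.vertexSet) :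
    G.dist u w = pendantDist G₁.dist v L u w :=
  (hP.isDistFun h).dist_eq hu hw

/-! ### Cost of a hypertree and its recursion -/

/-- The weighted sum of all distances. -/
noncomputable def weightedDist {α : Type*} (G : Hypergraph α) (V : Finset α) (x : α → ℝ) : ℝ :=
  ∑ u ∈ V, ∑ w ∈ V, x u * x w * G.dist u w

/-- The arrangement-dependent part of the weighted distance sum of a hypertree with `m` edges. -/
noncomputable def treeCost {α : Type*} (G : Hypergraph α) (m : ℕ) (V : Finset α) (x : α → ℝ) : ℝ :=
  m * (∑ u ∈ V, x u) ^ 2 - G.weightedDist V x - ∑ u ∈ V, x u ^ 2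

theorem sum_update_add {α : Type*} [DecidableEq α] {V : Finset α} {v : α} (hv : v ∈ V)
    (x c : α → ℝ) (b : ℝ) : ∑ u ∈ V, Function.update x v (x v + b) u * c u =
      ∑ u ∈ V, x u * c u + b * c v := by
  rw [← add_sum_erase _ _ hv, ← add_sum_erase _ (fun u => x u * c u) hv, Function.update_self,
    sum_congr rfl (g := fun u => x u * c u)]
  · ring
  · intro u hu
    rw [Function.update_of_ne (ne_of_mem_erase hu)]

/-- The quadratic term in `b` vanishes because `v` has distance 0 from itself. The recursion for
`treeCost` and the positivity of the extremal vector both use this. -/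
theorem weightedDist_update [DecidableEq α] {V : Finset α} (hv : v ∈ V) (hvv : G.dist v v = 0)
    (x : α → ℝ) (b : ℝ) : G.weightedDist V (Function.update x v (x v + b)) =
      G.weightedDist V x + 2 * b * ∑ u ∈ V, x u * G.dist u v := by
  have h1 : ∀ y : α → ℝ, G.weightedDist V y = ∑ u ∈ V, y u * ∑ w ∈ V, y w * G.dist u w := by
    intro y
    simp only [weightedDist, mul_sum, mul_assoc]
  rw [h1, h1, sum_update_add hv x (fun u => ∑ w ∈ V, _ * (G.dist u w : ℝ)),
    sum_congr rfl fun u _ => by rw [sum_update_add hv x (fun w => (G.dist u w : ℝ))],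
    sum_update_add hv x (fun w => (G.dist v w : ℝ)), hvv]
  simp only [mul_add, sum_add_distrib, G.dist_comm v]
  have : ∑ u ∈ V, x u * (b * (G.dist u v : ℝ)) = b * ∑ u ∈ V, x u * (G.dist u v : ℝ) := by
    rw [mul_sum]
    exact sum_congr rfl fun u _ => by ring
  rw [this]
  simp only [Nat.cast_zero]
  ring

/-- Seen from an old edge, the leaves lie in the branch of `v`, so their weight can be moved to `v`.
The new edge separates the old vertices, whose total appears squared, from leaves whose own squares
cancel. The last two terms undo the change of the square subtracted at `v`. -/
theorem treeCost_pendant [DecidableEq α] (hP : IsPendant G₁ G v L) (h : IsDistFun G₁ G₁.dist)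
    {m : ℕ} {V₁ V : Finset α} (hV₁ : G₁.vertexSet = ↑V₁) (hV : G.vertexSet = ↑V) {x : α → ℝ} {b : ℝ}
    (hb : ∑ u ∈ L, x u = b) :
    G.treeCost (m + 1) V x = G₁.treeCost m V₁ (Function.update x v (x v + b)) +
      (∑ u ∈ V₁, x u) ^ 2 + (x v + b) ^ 2 - x v ^ 2 := by
  have hv : v ∈ V₁ := by
    have := hP.mem
    rwa [hV₁, mem_coe] at this
  have hd : Disjoint V₁ L := by
    rw [disjoint_right]
    intro u hu
    have := hP.notMem u hu
    rwa [hV₁, mem_coe] at this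
  have hU : V = V₁ ∪ L := by
    have := hP.vertexSet_eq
    rw [hV, hV₁, ← coe_union] at this
    exact coe_injective this
  subst hU
  have hin : ∀ u ∈ V₁ ∪ L, u ∈ G.vertexSet := fun u hu => by rwa [hV, mem_coe]
  have hnL : ∀ u ∈ V₁, u ∉ L := fun u hu => disjoint_left.1 hd hu
  have d1 : ∀ u ∈ V₁, ∀ w ∈ V₁, x u * x w * G.dist u w = x u * x w * G₁.dist u w := by
    intro u hu w hw
    rw [hP.dist_eq h (hin u (mem_union_left _ hu)) (hin w (mem_union_left _ hw)), pendantDist,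
      if_neg (hnL u hu), if_neg (hnL w hw)]
  have d2 : ∀ u ∈ V₁, ∀ w ∈ L, x u * x w * G.dist u w = (x u * G₁.dist u v + x u) * x w := by
    intro u hu w hw
    rw [hP.dist_eq h (hin u (mem_union_left _ hu)) (hin w (mem_union_right _ hw)), pendantDist,
      if_neg (hnL u hu), if_pos hw]
    push_cast
    ring
  have d3 : ∀ u ∈ L, ∀ w ∈ V₁, x u * x w * G.dist u w = x u * (x w * G₁.dist w v + x w) := by
    intro u hu w hw
    rw [G.dist_comm, mul_comm (x u), d2 w hw u hu]
    ring
  have d4 : ∀ u ∈ L, ∀ w ∈ L, x u * x w * G.dist u w =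
      x u * x w - if u = w then x u * x w else 0 := by
    intro u hu w hw
    rw [hP.dist_eq h (hin u (mem_union_right _ hu)) (hin w (mem_union_right _ hw)), pendantDist,
      if_pos hu, if_pos hw]
    split_ifs <;> simp
  have hW : G.weightedDist (V₁ ∪ L) x = G₁.weightedDist V₁ x +
      2 * b * (∑ u ∈ V₁, x u * G₁.dist u v + ∑ u ∈ V₁, x u) + b ^ 2 - ∑ u ∈ L, x u ^ 2 := by
    unfold weightedDist
    rw [sum_union hd]
    simp only [sum_union hd, sum_add_distrib]
    rw [sum_congr rfl fun u hu => sum_congr rfl (d1 u hu),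
      sum_congr rfl fun u hu => sum_congr rfl (d2 u hu),
      sum_congr rfl fun u hu => sum_congr rfl (d3 u hu),
      sum_congr rfl fun u hu => sum_congr rfl (d4 u hu)]
    have e4 : ∑ u ∈ L, ∑ w ∈ L, (x u * x w - if u = w then x u * x w else 0) =
        b ^ 2 - ∑ u ∈ L, x u ^ 2 := by
      rw [← hb, sq, sum_mul_sum]
      simp only [sum_sub_distrib, sum_ite_eq]
      congr 1
      refine sum_congr rfl fun u hu => ?_
      rw [if_pos hu, sq]
    rw [e4, ← sum_mul_sum, ← sum_mul_sum, hb, sum_add_distrib]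
    ring
  have hS : ∑ u ∈ V₁, Function.update x v (x v + b) u = ∑ u ∈ V₁, x u + b := by
    simpa using sum_update_add hv x (fun _ => 1) b
  have hQ : ∑ u ∈ V₁, Function.update x v (x v + b) u ^ 2 =
      ∑ u ∈ V₁, x u ^ 2 + (x v + b) ^ 2 - x v ^ 2 := by
    rw [← add_sum_erase _ _ hv, ← add_sum_erase _ (fun u => x u ^ 2) hv, Function.update_self,
      sum_congr rfl (g := fun u => x u ^ 2)]
    · ring
    · intro u hu
      rw [Function.update_of_ne (ne_of_mem_erase hu)]
  unfold treeCost
  rw [hW, hS, hQ, weightedDist_update hv (h.self v hP.mem), sum_union hd, sum_union hd, hb]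
  push_cast
  ring

end

/-! ### Loose paths given by labellings -/

/-- `f` labels the vertices of `G` in such a way that `G` becomes the loose path with `m` edges of
`K + 1` vertices. -/
structure IsPathLabel {α : Type*} (K m : ℕ) (G : Hypergraph α) (f : ℕ → α) : Prop where
  bijOn : Set.BijOn f (range (m * K + 1)) G.vertexSet
  mem_edgeSet : ∀ e, e ∈ G.edgeSet ↔ ∃ i < m, e = f '' Set.Icc (i * K) (i * K + K)

section
variable {α : Type*} {K m : ℕ} {G : Hypergraph α} {f : ℕ → α}

/-- The last edge of a loose path is pendant at its joint, which makes statements about pendant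
edges applicable to loose paths by induction. -/
theorem IsPathLabel.split [DecidableEq α] (hK : 1 ≤ K) (h : IsPathLabel K (m + 1) G f) :
    ∃ G₁, IsPathLabel K m G₁ f ∧
      IsPendant G₁ G (f (m * K)) ((Ioc (m * K) (m * K + K)).image f) ∧
      ((Ioc (m * K) (m * K + K)).image f).card = K := by
  have e1 : (m + 1) * K + 1 = m * K + K + 1 := by ring
  have hinj := h.bijOn.injOn
  have hsub : (range (m * K + 1) : Set ℕ) ⊆ range ((m + 1) * K + 1) := by
    exact_mod_cast range_mono (by omega)
  have hunion : Set.Icc (m * K) (m * K + K) = insert (m * K) (Ioc (m * K) (m * K + K) : Set ℕ) := by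
    ext p
    simp only [Set.mem_Icc, Set.mem_insert_iff, coe_Ioc, Set.mem_Ioc]
    omega
  refine ⟨⟨f '' range (m * K + 1), {e | ∃ i < m, e = f '' Set.Icc (i * K) (i * K + K)}, ?_⟩,
    ⟨(hinj.mono hsub).bijOn_image, fun e => Iff.rfl⟩, ⟨?_, ?_, ?_, ?_⟩, ?_⟩
  · rintro e ⟨i, hi, rfl⟩
    refine Set.image_mono fun p hp => ?_
    have := block_le (K := K) hi
    have := hp.2
    simp only [coe_range, Set.mem_Iio]
    omega
  · exact ⟨m * K, by simp, rfl⟩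
  · rintro u hu ⟨p, hp, hpu⟩
    obtain ⟨q, hq, rfl⟩ := mem_image.1 hu
    rw [mem_Ioc] at hq
    have hp' : p < m * K + 1 := by simpa using hp
    have := hinj (hsub hp) (by simp only [coe_range, Set.mem_Iio]; omega) hpu
    omega
  · rw [← h.bijOn.image_eq, coe_image, ← Set.image_union]
    congr 1
    ext p
    simp only [coe_range, Set.mem_Iio, Set.mem_union, coe_Ioc, Set.mem_Ioc]
    omega
  · ext e
    rw [h.mem_edgeSet, coe_image, ← Set.image_insert_eq, ← hunion]
    simp only [Set.mem_insert_iff, Set.mem_ofPred_eq]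
    constructor
    · rintro ⟨i, hi, rfl⟩
      rcases Nat.lt_succ_iff_lt_or_eq.1 hi with hi | rfl
      · exact Or.inr ⟨i, hi, rfl⟩
      · exact Or.inl rfl
    · rintro (rfl | ⟨i, hi, rfl⟩)
      · exact ⟨m, by omega, rfl⟩
      · exact ⟨i, by omega, rfl⟩
  · rw [card_image_of_injOn, Nat.card_Ioc]
    · omega
    · refine hinj.mono fun p hp => ?_
      simp only [coe_Ioc, Set.mem_Ioc, coe_range, Set.mem_Iio] at hp ⊢
      omega

theorem IsPathLabel.single (h : IsPathLabel K 0 G f) : G.vertexSet = {f 0} ∧ G.edgeSet = ∅ := by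
  refine ⟨?_, ?_⟩
  · rw [← h.bijOn.image_eq]
    simp
  · ext e
    simp [h.mem_edgeSet]

theorem IsPathLabel.isBuilt (hK : 1 ≤ K) (h : IsPathLabel K m G f) : IsBuilt K m G := by
  classical
  induction m generalizing G with
  | zero => exact .single G _ h.single.1 h.single.2
  | succ m ih =>
    obtain ⟨G₁, h₁, hP, hc⟩ := h.split hK
    exact .pendant m G₁ G _ _ (ih h₁) hP hc

theorem sum_label {s : Set α} {V : Finset α} (hs : s = ↑V) {N : ℕ}
    (h : Set.BijOn f (range N) s) (x : α → ℝ) : ∑ u ∈ V, x u = ∑ p ∈ range N, x (f p) := by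
  subst hs
  symm
  exact sum_nbij f (fun p hp => mem_coe.1 (h.mapsTo (mem_coe.2 hp))) h.injOn h.surjOn
    fun _ _ => rfl

/-- Both costs obey the same recursion when the last edge is removed: compare `treeCost_pendant`
with `pathCost_succ`. -/
theorem IsPathLabel.treeCost_eq (hK : 1 ≤ K) (h : IsPathLabel K m G f) {V : Finset α}
    (hV : G.vertexSet = ↑V) (x : α → ℝ) : G.treeCost m V x = pathCost K m (x ∘ f) := by
  classical
  induction m generalizing G V x with
  | zero =>
    have h0 : V = {f 0} := by
      rw [h.single.1] at hV
      exact_mod_cast hV.symm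
    have := (h.isBuilt hK).isDistFun.self (f 0) (by simp [hV, h0])
    subst h0
    simp [treeCost, weightedDist, pathCost, this]
  | succ m ih =>
    obtain ⟨G₁, h₁, hP, hc⟩ := h.split hK
    have hV₁ : G₁.vertexSet = ((range (m * K + 1)).image f : Finset α) := by
      rw [← h₁.bijOn.image_eq, coe_image]
    have hinj := h.bijOn.injOn
    have e1 : (m + 1) * K + 1 = m * K + K + 1 := by ring
    have hsum : ∑ u ∈ (Ioc (m * K) (m * K + K)).image f, x u =
        ∑ p ∈ range K, (x ∘ f) (m * K + 1 + p) := by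
      rw [sum_image]
      · symm
        rw [← Finset.Ico_succ_succ_eq_Ioc, sum_Ico_eq_sum_range]
        simp only [Nat.succ_eq_succ, Nat.succ_eq_add_one]
        rw [show m * K + K + 1 - (m * K + 1) = K by omega]
        rfl
      · refine hinj.mono fun p hp => ?_
        simp only [coe_Ioc, Set.mem_Ioc, coe_range, Set.mem_Iio] at hp ⊢
        omega
    rw [treeCost_pendant hP (h₁.isBuilt hK).isDistFun hV₁ hV hsum, pathCost_succ hK _ rfl,
      ih h₁ hV₁, sum_label hV₁ h₁.bijOn]
    simp only [Function.comp]
    congr 3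
    refine pathCost_congr fun p hp => ?_
    simp only [Function.comp, Function.update_apply]
    congr 1
    rw [eq_iff_iff]
    exact hinj.eq_iff (by simp only [coe_range, Set.mem_Iio]; omega)
      (by simp only [coe_range, Set.mem_Iio]; omega)

end

/-! ### Reflecting, swapping, appending and inserting in labellings -/

section
variable {α : Type*} {K m : ℕ} {G₁ G : Hypergraph α} {f g : ℕ → α} {v : α} {L : Finset α}

theorem bijOn_of_surjOn {N : ℕ} {V : Finset α} {s : Set α} (hs : s = ↑V)
    (h1 : Set.MapsTo f (range N) s) (h2 : Set.SurjOn f (range N) s) (hc : N ≤ V.card) :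
    Set.BijOn f (range N) s := by
  subst hs
  refine ⟨h1, ?_, h2⟩
  exact injOn_of_surjOn_of_card_le f (by simpa [Set.MapsTo] using h1) (by simpa using h2)
    (by simpa using hc)

theorem bijOn_reflect {N : ℕ} {s : Set α} (h : Set.BijOn f (range (N + 1)) s) :
    Set.BijOn (fun p => f (N - p)) (range (N + 1)) s := by
  refine h.comp (g := f) (f := fun p => N - p) ⟨fun p _ => ?_, fun p hp q hq hpq => ?_,
    fun p hp => ⟨N - p, ?_, ?_⟩⟩ <;> simp only [coe_range, Set.mem_Iio] at * <;> omega

theorem bijOn_swap {N i j : ℕ} {s : Set α} (h : Set.BijOn f (range N) s) (hi : i < N)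
    (hj : j < N) : Set.BijOn (f ∘ Equiv.swap i j) (range N) s := by
  have key : ∀ p < N, Equiv.swap i j p < N := by
    intro p hp
    rw [Equiv.swap_apply_def]
    split_ifs <;> omega
  refine h.comp ⟨fun p hp => ?_, (Equiv.injective _).injOn, fun p hp => ⟨Equiv.swap i j p, ?_, ?_⟩⟩
  · simpa using key p (by simpa using hp)
  · simpa using key p (by simpa using hp)
  · simp

theorem IsPathLabel.reflect (h : IsPathLabel K m G f) :
    IsPathLabel K m G (fun p => f (m * K - p)) := by
  refine ⟨bijOn_reflect h.bijOn, fun e => ?_⟩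
  have key : ∀ i < m, (fun p => f (m * K - p)) '' Set.Icc (i * K) (i * K + K) =
      f '' Set.Icc ((m - 1 - i) * K) ((m - 1 - i) * K + K) := by
    intro i hi
    have h1 : m * K = (m - 1 - i) * K + i * K + K := by
      obtain ⟨d, rfl⟩ : ∃ d, m = i + d + 1 := ⟨m - 1 - i, by omega⟩
      rw [show i + d + 1 - 1 - i = d by omega]
      ring
    ext w
    constructor
    · rintro ⟨p, hp, rfl⟩
      rw [Set.mem_Icc] at hp
      exact ⟨m * K - p, Set.mem_Icc.2 (by omega), rfl⟩
    · rintro ⟨p, hp, rfl⟩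
      rw [Set.mem_Icc] at hp
      refine ⟨m * K - p, Set.mem_Icc.2 (by omega), ?_⟩
      simp only
      rw [Nat.sub_sub_self (by omega)]
  rw [h.mem_edgeSet]
  constructor
  · rintro ⟨i, hi, rfl⟩
    refine ⟨m - 1 - i, by omega, ?_⟩
    rw [key _ (by omega), show m - 1 - (m - 1 - i) = i by omega]
  · rintro ⟨i, hi, rfl⟩
    exact ⟨m - 1 - i, by omega, key i hi⟩

/-- Both swapped positions lie in the last edge and in no other, so every edge is preserved as a
set. -/
theorem IsPathLabel.swap_last {j : ℕ} (h : IsPathLabel K (m + 1) G f) (hj : m * K < j)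
    (hj' : j < m * K + K) : IsPathLabel K (m + 1) G (f ∘ Equiv.swap j ((m + 1) * K)) := by
  have e1 : (m + 1) * K = m * K + K := by ring
  refine ⟨bijOn_swap h.bijOn (by omega) (by omega), fun e => ?_⟩
  have key : ∀ i < m + 1, f ∘ Equiv.swap j ((m + 1) * K) '' Set.Icc (i * K) (i * K + K) =
      f '' Set.Icc (i * K) (i * K + K) := by
    intro i hi
    rw [Set.image_comp]
    congr 1
    rcases Nat.lt_succ_iff_lt_or_eq.1 hi with hi | rfl
    · have := block_le (K := K) hi
      refine (Set.image_congr fun p hp => ?_).trans (Set.image_id _)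
      rw [Set.mem_Icc] at hp
      rw [Equiv.swap_apply_of_ne_of_ne (by omega) (by omega), id]
    · rw [e1]
      refine Set.Subset.antisymm ?_ fun p hp => ⟨Equiv.swap j (i * K + K) p, ?_, by simp⟩
      · rintro _ ⟨p, hp, rfl⟩
        rw [Set.mem_Icc] at hp ⊢
        rw [Equiv.swap_apply_def]
        split_ifs <;> omega
      · rw [Set.mem_Icc] at hp ⊢
        rw [Equiv.swap_apply_def]
        split_ifs <;> omega
  rw [h.mem_edgeSet]
  constructor <;>
  · rintro ⟨i, hi, rfl⟩
    exact ⟨i, hi, by rw [key i hi]⟩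

/-- The labelling that continues a labelling `f` of `N` vertices by `g`. -/
def appendLabel (N : ℕ) (f g : ℕ → α) (p : ℕ) : α := if p < N then f p else g (p - N)

theorem appendLabel_add (N : ℕ) (f g : ℕ → α) (p : ℕ) : appendLabel N f g (N + p) = g p := by
  simp [appendLabel]

/-- The labelling obtained from `f` by inserting `g 0` before and `g 1, …, g (K - 1)` after the
vertex `f c`. -/
def insertLabel (K c : ℕ) (f g : ℕ → α) (p : ℕ) : α :=
  if p < c then f p else if p = c then g 0 else if p = c + 1 then f c else
    if p ≤ c + K then g (p - c - 1) else f (p - K)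

theorem IsPendant.card_eq (hP : IsPendant G₁ G v L) {N : ℕ}
    (hf : Set.BijOn f (range N) G₁.vertexSet) (hL : L.card = K) :
    ∃ V : Finset α, G.vertexSet = ↑V ∧ V.card = N + K := by
  classical
  refine ⟨(range N).image f ∪ L, ?_, ?_⟩
  · rw [hP.vertexSet_eq, coe_union, coe_image, hf.image_eq]
  · rw [card_union_of_disjoint, card_image_of_injOn hf.injOn, card_range, hL]
    rw [disjoint_left]
    intro u hu huL
    refine hP.notMem u huL ?_
    rw [← hf.image_eq, ← coe_image]
    exact hu

theorem bijOn_appendLabel (hP : IsPendant G₁ G v L) {N : ℕ}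
    (hf : Set.BijOn f (range N) G₁.vertexSet) (hL : L.card = K) (hg : Set.BijOn g (range K) L) :
    Set.BijOn (appendLabel N f g) (range (N + K)) G.vertexSet := by
  obtain ⟨V, hV, hc⟩ := hP.card_eq hf hL
  refine bijOn_of_surjOn hV ?_ ?_ hc.ge
  · intro p hp
    have hp' : p < N + K := by simpa using hp
    rw [hP.vertexSet_eq, appendLabel]
    split_ifs with h
    · exact Or.inl (hf.mapsTo (by simpa using h))
    · exact Or.inr (hg.mapsTo (by simp only [coe_range, Set.mem_Iio]; omega))
  · intro w hw
    rw [hP.vertexSet_eq] at hw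
    rcases hw with hw | hw
    · obtain ⟨p, hp, rfl⟩ := hf.surjOn hw
      have hp' : p < N := by simpa using hp
      exact ⟨p, by simp only [coe_range, Set.mem_Iio]; omega, by simp [appendLabel, hp']⟩
    · obtain ⟨p, hp, rfl⟩ := hg.surjOn hw
      have hp' : p < K := by simpa using hp
      exact ⟨N + p, by simp only [coe_range, Set.mem_Iio]; omega, by simp [appendLabel]⟩

theorem bijOn_insertLabel (hP : IsPendant G₁ G v L) {N c : ℕ}
    (hf : Set.BijOn f (range N) G₁.vertexSet) (hL : L.card = K) (hg : Set.BijOn g (range K) L)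
    (hK : 1 ≤ K) (hc : c < N) :
    Set.BijOn (insertLabel K c f g) (range (N + K)) G.vertexSet := by
  obtain ⟨V, hV, hcard⟩ := hP.card_eq hf hL
  have hf' : ∀ p < N, f p ∈ G.vertexSet := fun p hp => by
    rw [hP.vertexSet_eq]
    exact Or.inl (hf.mapsTo (by simpa using hp))
  have hg' : ∀ p < K, g p ∈ G.vertexSet := fun p hp => by
    rw [hP.vertexSet_eq]
    exact Or.inr (hg.mapsTo (by simpa using hp))
  refine bijOn_of_surjOn hV ?_ ?_ hcard.ge
  · intro p hp
    have hp' : p < N + K := by simpa using hp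
    rw [insertLabel]
    split_ifs
    · exact hf' _ (by omega)
    · exact hg' _ (by omega)
    · exact hf' _ (by omega)
    · exact hg' _ (by omega)
    · exact hf' _ (by omega)
  · intro w hw
    rw [hP.vertexSet_eq] at hw
    rcases hw with hw | hw
    · obtain ⟨p, hp, rfl⟩ := hf.surjOn hw
      have hp' : p < N := by simpa using hp
      rcases lt_trichotomy p c with h | rfl | h
      · exact ⟨p, by simp only [coe_range, Set.mem_Iio]; omega, by simp [insertLabel, h]⟩
      · exact ⟨p + 1, by simp only [coe_range, Set.mem_Iio]; omega, by simp [insertLabel]⟩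
      · refine ⟨p + K, by simp only [coe_range, Set.mem_Iio]; omega, ?_⟩
        rw [insertLabel, if_neg (by omega), if_neg (by omega), if_neg (by omega),
          if_neg (by omega), Nat.add_sub_cancel]
    · obtain ⟨p, hp, rfl⟩ := hg.surjOn hw
      have hp' : p < K := by simpa using hp
      rcases Nat.eq_zero_or_pos p with rfl | h
      · exact ⟨c, by simp only [coe_range, Set.mem_Iio]; omega, by simp [insertLabel]⟩
      · refine ⟨c + 1 + p, by simp only [coe_range, Set.mem_Iio]; omega, ?_⟩
        rw [insertLabel, if_neg (by omega), if_neg (by omega), if_neg (by omega),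
          if_pos (by omega)]
        congr 1
        omega

theorem IsPathLabel.append (h : IsPathLabel K m G₁ f) (hP : IsPendant G₁ G (f (m * K)) L)
    (hL : L.card = K) (hg : Set.BijOn g (range K) L) :
    IsPathLabel K (m + 1) G (appendLabel (m * K + 1) f g) := by
  have e1 : (m + 1) * K + 1 = m * K + 1 + K := by ring
  refine ⟨e1 ▸ bijOn_appendLabel hP h.bijOn hL hg, fun e => ?_⟩
  have k1 : ∀ i < m, appendLabel (m * K + 1) f g '' Set.Icc (i * K) (i * K + K) =
      f '' Set.Icc (i * K) (i * K + K) := by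
    intro i hi
    have := block_le (K := K) hi
    refine Set.image_congr fun p hp => ?_
    rw [Set.mem_Icc] at hp
    rw [appendLabel, if_pos (by omega)]
  have k2 : appendLabel (m * K + 1) f g '' Set.Icc (m * K) (m * K + K) =
      insert (f (m * K)) ↑L := by
    ext w
    constructor
    · rintro ⟨p, hp, rfl⟩
      rw [Set.mem_Icc] at hp
      rw [appendLabel]
      split_ifs with h
      · rw [show p = m * K by omega]
        exact Set.mem_insert _ _
      · exact Or.inr (hg.mapsTo (by simp only [coe_range, Set.mem_Iio]; omega))
    · rintro (rfl | hw)
      · exact ⟨m * K, Set.mem_Icc.2 (by omega), by simp [appendLabel]⟩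
      · obtain ⟨p, hp, rfl⟩ := hg.surjOn hw
        have hp' : p < K := by simpa using hp
        exact ⟨m * K + 1 + p, Set.mem_Icc.2 (by omega), appendLabel_add _ _ _ _⟩
  rw [hP.edgeSet_eq, Set.mem_insert_iff, h.mem_edgeSet]
  constructor
  · rintro (rfl | ⟨i, hi, rfl⟩)
    · exact ⟨m, by omega, k2.symm⟩
    · exact ⟨i, by omega, (k1 i hi).symm⟩
  · rintro ⟨i, hi, rfl⟩
    rcases Nat.lt_succ_iff_lt_or_eq.1 hi with hi | rfl
    · exact Or.inr ⟨i, hi, k1 i hi⟩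
    · exact Or.inl k2

variable {x : α → ℝ} {b : ℝ} {V₁ : Finset α}

theorem pathCost_appendLabel (hK : 1 ≤ K) (hV₁ : G₁.vertexSet = ↑V₁)
    (hf : Set.BijOn f (range (m * K + 1)) G₁.vertexSet) (hg : Set.BijOn g (range K) (L : Set α))
    (hb : ∑ u ∈ L, x u = b) :
    pathCost K (m + 1) (x ∘ appendLabel (m * K + 1) f g) =
      pathCost K m (Function.update (x ∘ f) (m * K) ((x ∘ f) (m * K) + b)) +
      (∑ u ∈ V₁, x u) ^ 2 + ((x ∘ f) (m * K) + b) ^ 2 - (x ∘ f) (m * K) ^ 2 := by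
  have h0 : ∀ p < m * K + 1, (x ∘ appendLabel (m * K + 1) f g) p = (x ∘ f) p := by
    intro p hp
    simp [appendLabel, hp]
  have hb' : ∑ p ∈ range K, (x ∘ appendLabel (m * K + 1) f g) (m * K + 1 + p) = b := by
    rw [← hb, sum_label rfl hg]
    exact sum_congr rfl fun p _ => congrArg x (appendLabel_add _ _ _ _)
  rw [pathCost_succ hK _ hb', h0 _ (by omega), sum_label hV₁ hf,
    sum_congr rfl fun p hp => h0 p (mem_range.1 hp)]
  simp only [Function.comp]
  congr 3
  refine pathCost_congr fun p hp => ?_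
  simp only [Function.update_apply]
  rw [h0 p hp]

variable [DecidableEq α]

theorem update_comp_label {N j p : ℕ} {s : Set α} (hf : Set.BijOn f (range N) s) (hj : j < N)
    (hp : p < N) (c : ℝ) : (Function.update x (f j) c ∘ f) p = Function.update (x ∘ f) j c p := by
  simp only [Function.comp, Function.update_apply]
  congr 1
  rw [eq_iff_iff]
  exact hf.injOn.eq_iff (by simpa using hp) (by simpa using hj)

theorem sum_update_label {N j : ℕ} (hV₁ : G₁.vertexSet = ↑V₁)
    (hf : Set.BijOn f (range N) G₁.vertexSet) (hj : j < N) (b : ℝ) :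
    ∑ p ∈ range N, (Function.update x (f j) (x (f j) + b) ∘ f) p = ∑ u ∈ V₁, x u + b := by
  have hv : f j ∈ V₁ := by
    have := hf.mapsTo (mem_coe.2 (mem_range.2 hj))
    rwa [hV₁, mem_coe] at this
  have h : ∑ u ∈ V₁, Function.update x (f j) (x (f j) + b) u = ∑ u ∈ V₁, x u + b := by
    simpa using sum_update_add hv x (fun _ => 1) b
  rw [← h, sum_label hV₁ hf]
  rfl

end

/-! ### Reattaching a pendant edge to an optimally labelled path -/

/-- The data of a hypergraph `G` with vertex weights `x` that arises from `G₁` by attaching a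
pendant edge with new vertices `g 0, …, g (K - 1)` of total weight `b` at `v`. -/
structure IsWeightedPendant {α : Type*} (K : ℕ) (G₁ G : Hypergraph α) (v : α) (L V₁ : Finset α)
    (g : ℕ → α) (x : α → ℝ) (b : ℝ) : Prop where
  isPendant : IsPendant G₁ G v L
  one_le : 1 ≤ K
  card_eq : L.card = K
  vertexSet_eq : G₁.vertexSet = ↑V₁
  bijOn : Set.BijOn g (range K) L
  sum_eq : ∑ u ∈ L, x u = b
  pos : ∀ u ∈ G.vertexSet, 0 < x u

section
variable {α : Type*} {K m : ℕ} {G₁ G : Hypergraph α} {f g : ℕ → α} {v : α}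
  {L V₁ : Finset α} {x : α → ℝ} {b : ℝ}

theorem IsWeightedPendant.b_pos (h : IsWeightedPendant K G₁ G v L V₁ g x b) : 0 < b := by
  rw [← h.sum_eq]
  refine sum_pos (fun u hu => h.pos u ?_) (card_pos.1 (by rw [h.card_eq]; exact h.one_le))
  rw [h.isPendant.vertexSet_eq]
  exact Or.inr hu

theorem IsWeightedPendant.pos_label (h : IsWeightedPendant K G₁ G v L V₁ g x b) {N : ℕ}
    (hf : Set.BijOn f (range N) G₁.vertexSet) {p : ℕ} (hp : p < N) : 0 < x (f p) := by
  refine h.pos _ ?_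
  rw [h.isPendant.vertexSet_eq]
  exact Or.inl (hf.mapsTo (by simpa using hp))

theorem IsWeightedPendant.bijOn_append (h : IsWeightedPendant K G₁ G v L V₁ g x b)
    (hf : Set.BijOn f (range (m * K + 1)) G₁.vertexSet) :
    Set.BijOn (appendLabel (m * K + 1) f g) (range ((m + 1) * K + 1)) G.vertexSet := by
  rw [show (m + 1) * K + 1 = m * K + 1 + K by ring]
  exact bijOn_appendLabel h.isPendant hf h.card_eq h.bijOn

/-- The labelling `f` minimises the path cost for the weights `x`. -/
def IsOptimalLabel (K m : ℕ) (G : Hypergraph α) (x : α → ℝ) (f : ℕ → α) : Prop :=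
  Set.BijOn f (range (m * K + 1)) G.vertexSet ∧
    ∀ f', Set.BijOn f' (range (m * K + 1)) G.vertexSet →
      pathCost K m (x ∘ f) ≤ pathCost K m (x ∘ f')

theorem IsOptimalLabel.reflect (hK : 1 ≤ K) (h : IsOptimalLabel K m G x f) :
    IsOptimalLabel K m G x fun p => f (m * K - p) := by
  refine ⟨bijOn_reflect h.1, fun f' hf' => ?_⟩
  exact (pathCost_reflect hK (x ∘ f)).trans_le (h.2 f' hf')

/-- In an optimal labelling, no interior vertex of an edge other than the first and the last one is
heavier than the lighter one of the two sides of the path. -/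
theorem IsOptimalLabel.le_left (h : IsOptimalLabel K m G x f) (hx : ∀ u ∈ G.vertexSet, 0 < x u)
    {i j : ℕ} (hi : i + 1 < m) (hj : (i + 1) * K < j) (hj' : j < (i + 1) * K + K)
    (hLR : ∑ p ∈ range ((i + 1) * K + 1), x (f p) ≤
      ∑ p ∈ range (m * K + 1), x (f p) - ∑ p ∈ range ((i + 1) * K + K), x (f p)) :
    x (f j) ≤ ∑ p ∈ range ((i + 1) * K + 1), x (f p) := by
  by_contra hlt
  have hm := block_le (K := K) hi
  have := pathCost_swap_lt (y := x ∘ f) (fun p hp => hx _ (h.1.mapsTo (by simpa using hp)))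
    hi hj hj'
    (not_le.1 hlt) hLR
  exact absurd (h.2 (f ∘ Equiv.swap (j - K) j) (bijOn_swap h.1 (by omega) (by omega)))
    (not_le.2 this)

theorem IsOptimalLabel.le_sides (hK : 1 ≤ K) (h : IsOptimalLabel K m G x f)
    (hx : ∀ u ∈ G.vertexSet, 0 < x u)
    {i j : ℕ} (hi : i + 2 < m) (hj : (i + 1) * K < j) (hj' : j < (i + 1) * K + K) :
    x (f j) ≤ ∑ p ∈ range ((i + 1) * K + 1), x (f p) ∧
    x (f j) ≤ ∑ p ∈ range (m * K + 1), x (f p) - ∑ p ∈ range ((i + 1) * K + K), x (f p) := by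
  by_cases hLR : ∑ p ∈ range ((i + 1) * K + 1), x (f p) ≤
      ∑ p ∈ range (m * K + 1), x (f p) - ∑ p ∈ range ((i + 1) * K + K), x (f p)
  · have := h.le_left hx (by omega) hj hj' hLR
    exact ⟨this, this.trans hLR⟩
  · obtain ⟨d, rfl⟩ : ∃ d, m = i + d + 3 := ⟨m - (i + 3), by omega⟩
    have e1 : (i + d + 3) * K = i * K + d * K + K + K + K := by ring
    have e2 : (i + 1) * K = i * K + K := by ring
    have e3 : (d + 1) * K = d * K + K := by ring
    have h1 := sum_range_reflected (N := (i + d + 3) * K) (t := (d + 1) * K + 1) (x ∘ f) (by omega)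
    have h2 := sum_range_reflected (N := (i + d + 3) * K) (t := (d + 1) * K + K) (x ∘ f) (by omega)
    have h3 := sum_range_reflected (N := (i + d + 3) * K) (x ∘ f) le_rfl
    rw [show (i + d + 3) * K + 1 - ((d + 1) * K + 1) = (i + 1) * K + K by omega] at h1
    rw [show (i + d + 3) * K + 1 - ((d + 1) * K + K) = (i + 1) * K + 1 by omega] at h2
    simp only [Function.comp, Nat.sub_self, range_zero, sum_empty, sub_zero] at h1 h2 h3
    -- With `m = i + d + 3` edges, reflection sends edge `i + 1` to edge `d + 1`, so the bound for
    -- the lighter left side applies to the mirrored labelling.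
    have := (h.reflect hK).le_left hx (i := d) (j := (i + d + 3) * K - j) (by omega) (by omega)
      (by omega) (by rw [h1, h2, h3]; linarith)
    rw [h1, Nat.sub_sub_self (by omega)] at this
    exact ⟨by linarith, this⟩

/-- The cost sees only the labels of positions up to `m * K`, so finitely many values occur and a
minimum exists. -/
theorem exists_isOptimalLabel (x : α → ℝ) {V : Finset α} (hV : G.vertexSet = ↑V)
    (hf : Set.BijOn f (range (m * K + 1)) G.vertexSet) : ∃ f', IsOptimalLabel K m G x f' := by
  have hfin : {c | ∃ f', Set.BijOn f' (range (m * K + 1)) G.vertexSet ∧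
      c = pathCost K m (x ∘ f')}.Finite := by
    refine (Set.finite_range fun φ : Fin (m * K + 1) → V => pathCost K m fun p =>
      if h : p < m * K + 1 then x (φ ⟨p, h⟩) else 0).subset ?_
    rintro c ⟨f', hf', rfl⟩
    refine ⟨fun p => ⟨f' p, ?_⟩, pathCost_congr fun p hp => by simp [hp]⟩
    have := hf'.mapsTo (mem_coe.2 (mem_range.2 p.2))
    rwa [hV, mem_coe] at this
  obtain ⟨_, ⟨f', hf', rfl⟩, hmin⟩ := Set.exists_min_image _ id hfin ⟨_, f, hf, rfl⟩
  exact ⟨f', hf', fun f'' hf'' => hmin _ ⟨f'', hf'', rfl⟩⟩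

variable [DecidableEq α]

/-- There is a labelling of `G` that is at most as expensive as hanging the pendant edge to the
path given by the labelling `f` of `G₁`; and it is cheaper, or it inherits the property to turn the
hypergraph into a loose path. -/
def HasGoodLabel (K m : ℕ) (G₁ G : Hypergraph α) (v : α) (V₁ : Finset α) (x : α → ℝ) (b : ℝ)
    (f : ℕ → α) : Prop :=
  ∃ f', Set.BijOn f' (range ((m + 1) * K + 1)) G.vertexSet ∧
    (pathCost K (m + 1) (x ∘ f') < pathCost K m (Function.update x v (x v + b) ∘ f) +
      (∑ u ∈ V₁, x u) ^ 2 + (x v + b) ^ 2 - x v ^ 2 ∨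
    pathCost K (m + 1) (x ∘ f') = pathCost K m (Function.update x v (x v + b) ∘ f) +
      (∑ u ∈ V₁, x u) ^ 2 + (x v + b) ^ 2 - x v ^ 2 ∧
      (IsPathLabel K m G₁ f → IsPathLabel K (m + 1) G f'))

theorem HasGoodLabel.of_reflect (hK : 1 ≤ K)
    (h : HasGoodLabel K m G₁ G v V₁ x b fun p => f (m * K - p)) :
    HasGoodLabel K m G₁ G v V₁ x b f := by
  obtain ⟨f', hf', h⟩ := h
  have e := pathCost_reflect (m := m) hK (Function.update x v (x v + b) ∘ f)
  refine ⟨f', hf', ?_⟩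
  rw [← e]
  exact h.imp id fun h => ⟨h.1, fun hp => h.2 hp.reflect⟩

theorem IsWeightedPendant.pos_update (h : IsWeightedPendant K G₁ G v L V₁ g x b) {N : ℕ}
    (hf : Set.BijOn f (range N) G₁.vertexSet) {p : ℕ} (hp : p < N) :
    0 < (Function.update x v (x v + b) ∘ f) p := by
  have := h.b_pos
  rw [Function.comp, Function.update_apply]
  split_ifs with h'
  · have := h.pos_label hf hp
    rw [h'] at this
    linarith
  · exact h.pos_label hf hp

/-- This, up to the symmetries of the path, is the case where equality can occur: the pendant edge
already continues the path, and the cost is unchanged. -/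
theorem IsWeightedPendant.goodLabel_end (h : IsWeightedPendant K G₁ G v L V₁ g x b)
    (hf : Set.BijOn f (range (m * K + 1)) G₁.vertexSet) (hv : f (m * K) = v) :
    HasGoodLabel K m G₁ G v V₁ x b f := by
  refine ⟨appendLabel (m * K + 1) f g, h.bijOn_append hf, Or.inr ⟨?_, fun hp => ?_⟩⟩
  · rw [pathCost_appendLabel h.one_le h.vertexSet_eq hf h.bijOn h.sum_eq]
    subst hv
    simp only [Function.comp]
    congr 3
    refine pathCost_congr fun p hp => ?_
    exact (update_comp_label hf (by omega) hp _).symm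
  · subst hv
    exact hp.append h.isPendant h.card_eq h.bijOn

theorem IsWeightedPendant.goodLabel_last (h : IsWeightedPendant K G₁ G v L V₁ g x b)
    (hf : Set.BijOn f (range ((m + 1) * K + 1)) G₁.vertexSet) {j : ℕ} (hj : m * K < j)
    (hj' : j ≤ (m + 1) * K) (hv : f j = v) : HasGoodLabel K (m + 1) G₁ G v V₁ x b f := by
  have e1 : (m + 1) * K = m * K + K := by ring
  rcases hj'.eq_or_lt with rfl | hj'
  · exact h.goodLabel_end hf hv
  · obtain ⟨f', hf', h'⟩ := h.goodLabel_end (m := m + 1) (f := f ∘ Equiv.swap j ((m + 1) * K))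
      (bijOn_swap hf (by omega) (by omega)) (by simp [hv])
    rw [← Function.comp_assoc, pathCost_swap_last _ hj (by omega)] at h'
    exact ⟨f', hf', h'.imp id fun h' => ⟨h'.1, fun hp => h'.2 (hp.swap_last hj (by omega))⟩⟩

theorem IsWeightedPendant.goodLabel_joint_of_le (h : IsWeightedPendant K G₁ G v L V₁ g x b)
    (hf : Set.BijOn f (range (m * K + 1)) G₁.vertexSet) {i : ℕ} (hi : i < m) (hv : f (i * K) = v)
    (hLR : ∑ p ∈ range (m * K + 1), x (f p) - ∑ p ∈ range (i * K + 1), x (f p) ≤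
      ∑ p ∈ range (i * K), x (f p)) : HasGoodLabel K m G₁ G v V₁ x b f := by
  refine ⟨appendLabel (m * K + 1) f g, h.bijOn_append hf, Or.inl ?_⟩
  rw [pathCost_appendLabel h.one_le h.vertexSet_eq hf h.bijOn h.sum_eq]
  have := pathCost_append_lt (y := x ∘ f) h.one_le (fun p hp => h.pos_label hf hp) h.b_pos hi hLR
  have hm := block_le (K := K) hi
  have e : pathCost K m (Function.update x v (x v + b) ∘ f) =
      pathCost K m (Function.update (x ∘ f) (i * K) ((x ∘ f) (i * K) + b)) := by
    subst hv
    exact pathCost_congr fun p hp => update_comp_label hf (by omega) hp _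
  rw [e]
  simp only [Function.comp, hv] at this ⊢
  linarith

/-- One of the two sides of the joint is the lighter one; after a reflection if necessary, it is the
right one. Joint 0 is excluded since its mirror image is the right end, where nothing is gained. -/
theorem IsWeightedPendant.goodLabel_joint (h : IsWeightedPendant K G₁ G v L V₁ g x b)
    (hf : Set.BijOn f (range (m * K + 1)) G₁.vertexSet) {i : ℕ} (hi0 : 0 < i) (hi : i < m)
    (hv : f (i * K) = v) : HasGoodLabel K m G₁ G v V₁ x b f := by
  have hm := block_le (K := K) hi
  by_cases hLR : ∑ p ∈ range (m * K + 1), x (f p) - ∑ p ∈ range (i * K + 1), x (f p) ≤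
      ∑ p ∈ range (i * K), x (f p)
  · exact h.goodLabel_joint_of_le hf hi hv hLR
  · have hsub : (m - i) * K = m * K - i * K := Nat.sub_mul _ _ _
    refine .of_reflect h.one_le (h.goodLabel_joint_of_le (bijOn_reflect hf) (i := m - i)
      (by omega) ?_ ?_)
    · rw [hsub, Nat.sub_sub_self (by omega), hv]
    · have h1 := sum_range_reflected (N := m * K) (x ∘ f) le_rfl
      have h2 := sum_range_reflected (N := m * K) (t := m * K - i * K + 1) (x ∘ f) (by omega)
      have h3 := sum_range_reflected (N := m * K) (t := m * K - i * K) (x ∘ f) (by omega)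
      rw [show m * K + 1 - (m * K - i * K + 1) = i * K by omega] at h2
      rw [show m * K + 1 - (m * K - i * K) = i * K + 1 by omega] at h3
      simp only [Function.comp, Nat.sub_self, range_zero, sum_empty, sub_zero] at h1 h2 h3
      rw [hsub, h1, h2, h3]
      linarith

/-- The host edge is cut at `v`, placed just before the right joint. Vertex `v` becomes the new
joint, `g 0` takes its former position, and the other leaves fill the new edge between `v` and the
old joint. -/
theorem IsWeightedPendant.exists_lt_of_insert (h : IsWeightedPendant K G₁ G v L V₁ g x b)
    (hf : Set.BijOn f (range (m * K + 1)) G₁.vertexSet) (hK : 2 ≤ K) {i c : ℕ} (hi : i < m)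
    (hc : c + 1 = i * K + K) (hv : f c = v)
    (hL : x v + b ≤ ∑ p ∈ range (i * K + 1), (Function.update x v (x v + b) ∘ f) p)
    (hR : x v + b ≤ ∑ p ∈ range (m * K + 1), (Function.update x v (x v + b) ∘ f) p -
      ∑ p ∈ range (i * K + K), (Function.update x v (x v + b) ∘ f) p) :
    ∃ f', Set.BijOn f' (range ((m + 1) * K + 1)) G.vertexSet ∧
      pathCost K (m + 1) (x ∘ f') < pathCost K m (Function.update x v (x v + b) ∘ f) +
        (∑ u ∈ V₁, x u) ^ 2 + (x v + b) ^ 2 - x v ^ 2 := by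
  have hm := block_le (K := K) hi
  have hbij : Set.BijOn (insertLabel K c f g) (range ((m + 1) * K + 1)) G.vertexSet := by
    rw [show (m + 1) * K + 1 = m * K + 1 + K by ring]
    exact bijOn_insertLabel h.isPendant hf h.card_eq h.bijOn h.one_le (by omega)
  refine ⟨insertLabel K c f g, hbij, ?_⟩
  have hS := sum_update_label (x := x) (j := c) h.vertexSet_eq hf (by omega) b
  rw [hv] at hS
  have hne : ∀ p < m * K + 1, p ≠ c → (Function.update x v (x v + b) ∘ f) p = x (f p) := by
    intro p hp hpc
    subst hv
    rw [update_comp_label hf (by omega) hp, Function.update_of_ne hpc]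
    rfl
  have := pathCost_insert_lt (y := Function.update x v (x v + b) ∘ f)
    (y' := x ∘ insertLabel K c f g) (z := x ∘ g) (a := x v) (b := b) hK
    (fun p hp => h.pos_update hf hp) hi hc (fun p hp => h.pos _ ?_) ?_ ?_ ?_ ?_ ?_ ?_ ?_ ?_ hL hR
  · rwa [hS, add_sub_cancel_right] at this
  · rw [h.isPendant.vertexSet_eq]
    exact Or.inr (h.bijOn.mapsTo (by simpa using hp))
  · rw [← h.sum_eq, sum_label rfl h.bijOn]
    rfl
  · rw [← hv]
    exact h.pos_label hf (by omega)
  · simp [hv]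
  · intro p hp
    rw [hne p (by omega) hp.ne]
    simp [insertLabel, hp]
  · simp [insertLabel]
  · simp [insertLabel, hv]
  · intro p hp
    simp only [Function.comp, insertLabel]
    rw [if_neg (by omega), if_neg (by omega), if_neg (by omega), if_pos (by omega)]
    congr 2
    omega
  · intro p hp hp'
    rw [hne p (by omega) hp.ne']
    simp only [Function.comp, insertLabel]
    rw [if_neg (by omega), if_neg (by omega), if_neg (by omega), if_neg (by omega),
      Nat.add_sub_cancel]

theorem IsWeightedPendant.goodLabel_interior (h : IsWeightedPendant K G₁ G v L V₁ g x b)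
    (hf : IsOptimalLabel K m G₁ (Function.update x v (x v + b)) f) {i j : ℕ} (hi : i + 2 < m)
    (hj : (i + 1) * K < j) (hj' : j < (i + 1) * K + K) (hv : f j = v) :
    HasGoodLabel K m G₁ G v V₁ x b f := by
  have hm := block_le (K := K) (show i + 1 < m by omega)
  have hpos : ∀ u ∈ G₁.vertexSet, 0 < Function.update x v (x v + b) u := by
    intro u hu
    obtain ⟨p, hp, rfl⟩ := hf.1.surjOn hu
    exact h.pos_update hf.1 (by simpa using hp)
  obtain ⟨hL, hR⟩ := hf.le_sides h.one_le hpos hi hj hj'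
  -- The insertion needs `v` at the last interior position `c` of its edge. Swapping it there
  -- changes neither the cost nor the two side sums.
  obtain ⟨c, hc⟩ : ∃ c, c + 1 = (i + 1) * K + K := ⟨(i + 1) * K + K - 1, by omega⟩
  have e := pathCost_swap_interior (i := i + 1) (p := j) (q := c)
    (Function.update x v (x v + b) ∘ f) (show i + 1 < m by omega) hj hj' (by omega) (by omega)
  have s1 := sum_range_swap (y := Function.update x v (x v + b) ∘ f) (p := j) (q := c)
    (t := (i + 1) * K + 1) (by omega)
  have s2 := sum_range_swap (y := Function.update x v (x v + b) ∘ f) (p := j) (q := c)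
    (t := (i + 1) * K + K) (by omega)
  have s3 := sum_range_swap (y := Function.update x v (x v + b) ∘ f) (p := j) (q := c)
    (t := m * K + 1) (by omega)
  rw [hv, Function.update_self] at hL hR
  simp only [Function.comp] at s1 s2 s3
  have hbij := bijOn_swap hf.1 (show j < m * K + 1 by omega) (show c < m * K + 1 by omega)
  obtain ⟨f', hf', h'⟩ := h.exists_lt_of_insert (m := m) (f := f ∘ Equiv.swap j c) hbij
    (by omega) (show i + 1 < m by omega) hc (by simp [hv]) (by simp only [Function.comp]; rwa [s1])
    (by simp only [Function.comp]; rwa [s2, s3])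
  rw [← Function.comp_assoc, e] at h'
  exact ⟨f', hf', Or.inl h'⟩

theorem IsWeightedPendant.goodLabel (h : IsWeightedPendant K G₁ G v L V₁ g x b)
    (hf : IsOptimalLabel K m G₁ (Function.update x v (x v + b)) f) :
    HasGoodLabel K m G₁ G v V₁ x b f := by
  have hK := h.one_le
  obtain ⟨j, hj, hv⟩ := hf.1.surjOn h.isPendant.mem
  have hj : j ≤ m * K := by
    have : j < m * K + 1 := by simpa using hj
    omega
  rcases m with _ | m
  · exact h.goodLabel_end hf.1 (by rwa [show 0 * K = j by omega])
  have e1 : (m + 1) * K = m * K + K := by ring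
  by_cases hlast : m * K < j
  · exact h.goodLabel_last hf.1 hlast hj hv
  -- Position 0 counts as part of the first edge, so the remaining joints are inner ones and the
  -- remaining interior vertices lie in middle edges.
  by_cases hfirst : j < K
  · refine .of_reflect hK (h.goodLabel_last (bijOn_reflect hf.1)
      (j := (m + 1) * K - j) (by omega) (by omega) ?_)
    rw [Nat.sub_sub_self hj, hv]
  have hdiv := Nat.div_add_mod j K
  have hmod := Nat.mod_lt j hK
  rw [mul_comm] at hdiv
  obtain ⟨i, hi⟩ : ∃ i, j / K = i + 1 :=
    Nat.exists_eq_succ_of_ne_zero (Nat.div_pos (not_lt.1 hfirst) hK).ne'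
  rw [hi] at hdiv
  rcases Nat.eq_zero_or_pos (j % K) with h0 | h0
  · refine h.goodLabel_joint hf.1 (i := i + 1) (by omega) ?_ (by rw [← hv]; congr 1; omega)
    by_contra hlt
    have := Nat.mul_le_mul_right K (not_lt.1 hlt)
    omega
  · refine h.goodLabel_interior hf (i := i) ?_ (by omega) (by omega) hv
    by_contra hlt
    have := Nat.mul_le_mul_right K (show m ≤ i + 1 by omega)
    omega

/-- Some loose path on the vertices of a hypertree has at most the cost of the hypertree, and a
smaller one unless the hypertree is a loose path itself. -/
theorem IsBuilt.exists_label (hK : 1 ≤ K) (h : IsBuilt K m G) {V : Finset α}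
    (hV : G.vertexSet = ↑V) {x : α → ℝ} (hx : ∀ u ∈ G.vertexSet, 0 < x u) :
    ∃ f, Set.BijOn f (range (m * K + 1)) G.vertexSet ∧
      pathCost K m (x ∘ f) ≤ G.treeCost m V x ∧
      ((∃ f', IsPathLabel K m G f') ∨ pathCost K m (x ∘ f) < G.treeCost m V x) := by
  induction h generalizing V x with
  | single G v hV' hE =>
    have hp : IsPathLabel K 0 G fun _ => v := by
      refine ⟨?_, by simp [hE]⟩
      rw [hV']
      simp [Set.BijOn, Set.MapsTo, Set.SurjOn]
    exact ⟨_, hp.bijOn, (hp.treeCost_eq hK hV x).ge, Or.inl ⟨_, hp⟩⟩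
  | pendant m G₁ G v L h₁ hP hL ih =>
    have hG₁ : G₁.vertexSet ⊆ G.vertexSet := by
      rw [hP.vertexSet_eq]
      exact Set.subset_union_left
    obtain ⟨V₁, hV₁⟩ : ∃ V₁ : Finset α, G₁.vertexSet = ↑V₁ :=
      ⟨_, (((V.finite_toSet.subset (hV ▸ hG₁)).coe_toFinset)).symm⟩
    obtain ⟨g, hg⟩ : ∃ g : ℕ → α, Set.BijOn g (range K) (L : Set α) := by
      have : Nonempty α := ⟨v⟩
      exact (range K).finite_toSet.exists_bijOn_of_encard_eq
        (by rw [Set.encard_coe_eq_coe_finsetCard, Set.encard_coe_eq_coe_finsetCard, hL, card_range])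
    have hw : IsWeightedPendant K G₁ G v L V₁ g x (∑ u ∈ L, x u) :=
      ⟨hP, hK, hL, hV₁, hg, rfl, hx⟩
    set b := ∑ u ∈ L, x u with hb
    have hx' : ∀ u ∈ G₁.vertexSet, 0 < Function.update x v (x v + b) u := by
      intro u hu
      rw [Function.update_apply]
      split_ifs
      · have h1 := hw.b_pos
        have h2 := hx v (hG₁ hP.mem)
        linarith
      · exact hx u (hG₁ hu)
    obtain ⟨f₁, hf₁, hle, hpath⟩ := ih hV₁ hx'
    -- To pass on the equality case, an optimal labelling is wanted that exhibits `G₁` as a loose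
    -- path whenever equality is still possible. If the labelling witnessing that `G₁` is a loose
    -- path is optimal, it is kept; otherwise any optimal labelling is already strictly cheaper.
    obtain ⟨f, hf, hcost, hor⟩ : ∃ f, IsOptimalLabel K m G₁ (Function.update x v (x v + b)) f ∧
        pathCost K m (Function.update x v (x v + b) ∘ f) ≤
          G₁.treeCost m V₁ (Function.update x v (x v + b)) ∧
        (IsPathLabel K m G₁ f ∨ pathCost K m (Function.update x v (x v + b) ∘ f) <
          G₁.treeCost m V₁ (Function.update x v (x v + b))) := by
      obtain ⟨f₀, h₀⟩ := exists_isOptimalLabel (Function.update x v (x v + b)) hV₁ hf₁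
      rcases hpath with ⟨f₂, hf₂⟩ | hlt
      · have e := hf₂.treeCost_eq hK hV₁ (Function.update x v (x v + b))
        rcases (h₀.2 f₂ hf₂.bijOn).eq_or_lt with heq | hlt
        · refine ⟨f₂, ⟨hf₂.bijOn, fun f' hf' => ?_⟩, e.ge, Or.inl hf₂⟩
          exact heq.symm.trans_le (h₀.2 f' hf')
        · rw [← e] at hlt
          exact ⟨f₀, h₀, hlt.le, Or.inr hlt⟩
      · have := (h₀.2 f₁ hf₁).trans_lt hlt
        exact ⟨f₀, h₀, this.le, Or.inr this⟩
    rw [treeCost_pendant hP h₁.isDistFun hV₁ hV hb.symm]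
    obtain ⟨f', hf', hlt | ⟨heq, himp⟩⟩ := hw.goodLabel hf
    · exact ⟨f', hf', by linarith, Or.inr (by linarith)⟩
    · refine ⟨f', hf', by linarith, hor.imp (fun h => ⟨f', himp h⟩) fun h => by linarith⟩

end

/-! ### Paths, cycles and pendant edges in hypertrees -/

section
variable {α : Type*} {G G₁ : Hypergraph α}

/-- A path of length `p` in `G`, as a pair of sequences. -/
structure IsPathSeq (G : Hypergraph α) (p : ℕ) (v : ℕ → α) (e : ℕ → Set α) : Prop where
  mem_vertexSet : ∀ i ≤ p, v i ∈ G.vertexSet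
  mem_edgeSet : ∀ i < p, e i ∈ G.edgeSet
  left_mem : ∀ i < p, v i ∈ e i
  right_mem : ∀ i < p, v (i + 1) ∈ e i
  vertex_inj : ∀ i ≤ p, ∀ j ≤ p, v i = v j → i = j
  edge_inj : ∀ i < p, ∀ j < p, e i = e j → i = j

theorem IsPathSeq.isPath {p : ℕ} {v : ℕ → α} {e : ℕ → Set α} (h : IsPathSeq G p v e) :
    G.IsPath p (fun i => v i) (fun i => e i) where
  isWalk :=
    { mem_vertexSet := fun i => h.mem_vertexSet i (by omega)
      mem_edgeSet := fun i => h.mem_edgeSet i i.2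
      left_mem := fun i => h.left_mem i i.2
      right_mem := fun i => h.right_mem i i.2
      ne := fun i hi => by
        have := h.vertex_inj i (by omega) (i + 1) (by omega) hi
        omega }
  vertex_injective i j hij := Fin.ext (h.vertex_inj i (by omega) j (by omega) hij)
  edge_injective i j hij := Fin.ext (h.edge_inj i i.2 j j.2 hij)

theorem HasPath.exists_seq {u w : α} {p : ℕ} (h : G.HasPath u w p) :
    ∃ v e, IsPathSeq G p v e ∧ v 0 = u ∧ v p = w := by
  obtain ⟨v, e, h, rfl, rfl⟩ := h
  refine ⟨fun i => if hi : i < p + 1 then v ⟨i, hi⟩ else v 0,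
    fun i => if hi : i < p then e ⟨i, hi⟩ else ∅, ⟨fun i hi => ?_, fun i hi => ?_, fun i hi => ?_,
    fun i hi => ?_, fun i hi j hj hij => ?_, fun i hi j hj hij => ?_⟩, ?_, ?_⟩
  · simpa [Nat.lt_succ_iff.2 hi] using h.isWalk.mem_vertexSet _
  · simpa [hi] using h.isWalk.mem_edgeSet _
  · simpa [hi, hi.le, Nat.lt_succ_iff] using h.isWalk.left_mem ⟨i, hi⟩
  · simpa [hi] using h.isWalk.right_mem ⟨i, hi⟩
  · simp only [Nat.lt_succ_iff.2 hi, Nat.lt_succ_iff.2 hj, dif_pos] at hij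
    simpa using h.vertex_injective hij
  · simp only [hi, hj, dif_pos] at hij
    simpa using h.edge_injective hij
  · simp
  · simp [Fin.last]

/-- In an acyclic hypergraph an edge through two vertices of a path is one of the edges of the path
between these vertices. -/
theorem IsPathSeq.exists_edge_eq
    (hG : ∀ (p : ℕ) (v : Fin (p + 1) → α) (e : Fin p → Set α), ¬ G.IsCycle p v e) {p : ℕ}
    {v : ℕ → α} {e : ℕ → Set α} (h : IsPathSeq G p v e) {i j : ℕ} (hij : i < j) (hj : j ≤ p)
    {E : Set α} (hE : E ∈ G.edgeSet) (hi' : v i ∈ E) (hj' : v j ∈ E) :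
    ∃ l, i ≤ l ∧ l < j ∧ e l = E := by
  by_contra! hne
  obtain ⟨q, rfl⟩ : ∃ q, j = i + q := ⟨j - i, by omega⟩
  -- If `E` were none of these edges, it would close the segment from `v i` to `v j` to a cycle.
  refine hG (q + 1) (fun t => if (t : ℕ) ≤ q then v (i + t) else v i)
    (fun t => if (t : ℕ) < q then e (i + t) else E)
    ⟨⟨fun t => ?_, fun t => ?_, fun t => ?_, fun t => ?_, fun t => ?_⟩, by omega,
      fun s t hst => ?_, fun s t hst => ?_, ?_⟩
  · split_ifs
    · exact h.mem_vertexSet _ (by omega)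
    · exact h.mem_vertexSet _ (by omega)
  · split_ifs
    · exact h.mem_edgeSet _ (by omega)
    · exact hE
  · have ht := t.2
    simp only [Fin.val_castSucc]
    rw [if_pos (show (t : ℕ) ≤ q by omega)]
    split_ifs
    · exact h.left_mem _ (by omega)
    · rwa [show (t : ℕ) = q by omega]
  · have ht := t.2
    simp only [Fin.val_succ]
    by_cases htq : (t : ℕ) < q
    · rw [if_pos (show (t : ℕ) + 1 ≤ q by omega), if_pos htq]
      exact h.right_mem _ (by omega)
    · rw [if_neg (show ¬ (t : ℕ) + 1 ≤ q by omega), if_neg htq]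
      exact hi'
  · have ht := t.2
    simp only [Fin.val_succ, Fin.val_castSucc]
    rw [if_pos (by omega)]
    split_ifs
    · intro h'
      have := h.vertex_inj _ (by omega) _ (by omega) h'
      omega
    · intro h'
      have := h.vertex_inj _ (by omega) _ (by omega) h'
      omega
  · have hs := s.2
    have ht := t.2
    ext
    split_ifs at hst
    · have := h.edge_inj _ (by omega) _ (by omega) hst
      omega
    · exact absurd hst (hne _ (by omega) (by omega))
    · exact absurd hst.symm (hne _ (by omega) (by omega))
    · omega
  · have hs := s.2
    have ht := t.2
    ext
    simp only [Fin.val_castSucc] at hst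
    rw [if_pos (by omega), if_pos (by omega)] at hst
    have := h.vertex_inj _ (by omega) _ (by omega) hst
    omega
  · simp

theorem IsPathSeq.update_last {p : ℕ} {v : ℕ → α} {e : ℕ → Set α} (h : IsPathSeq G (p + 1) v e)
    {z : α} (hz : z ∈ e p) (hne : ∀ i ≤ p, v i ≠ z) :
    IsPathSeq G (p + 1) (fun i => if i ≤ p then v i else z) e where
  mem_vertexSet i hi := by
    split_ifs
    · exact h.mem_vertexSet i hi
    · exact mem_vertexSet_of_mem_edgeSet (h.mem_edgeSet p (by omega)) hz
  mem_edgeSet := h.mem_edgeSet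
  left_mem i hi := by
    rw [if_pos (show i ≤ p by omega)]
    exact h.left_mem i hi
  right_mem i hi := by
    split_ifs
    · exact h.right_mem i hi
    · rwa [show i = p by omega]
  vertex_inj i hi j hj hij := by
    split_ifs at hij with h1 h2 h2
    · exact h.vertex_inj i hi j hj hij
    · exact absurd hij (hne i h1)
    · exact absurd hij.symm (hne j h2)
    · omega
  edge_inj := h.edge_inj

theorem IsPathSeq.extend {p : ℕ} {v : ℕ → α} {e : ℕ → Set α} (h : IsPathSeq G p v e)
    {y : α} {E : Set α} (hE : E ∈ G.edgeSet) (hv : v p ∈ E) (hy : y ∈ E)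
    (hne : ∀ i ≤ p, v i ≠ y) (hne' : ∀ i < p, e i ≠ E) :
    IsPathSeq G (p + 1) (fun i => if i ≤ p then v i else y)
      (fun i => if i < p then e i else E) where
  mem_vertexSet i hi := by
    split_ifs with h1
    · exact h.mem_vertexSet i h1
    · exact mem_vertexSet_of_mem_edgeSet hE hy
  mem_edgeSet i hi := by
    split_ifs with h1
    · exact h.mem_edgeSet i h1
    · exact hE
  left_mem i hi := by
    rw [if_pos (show i ≤ p by omega)]
    split_ifs with h1
    · exact h.left_mem i h1
    · rwa [show i = p by omega]
  right_mem i hi := by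
    by_cases h1 : i < p
    · rw [if_pos (show i + 1 ≤ p by omega), if_pos h1]
      exact h.right_mem i h1
    · rw [if_neg (show ¬ i + 1 ≤ p by omega), if_neg h1]
      exact hy
  vertex_inj i hi j hj hij := by
    split_ifs at hij with h1 h2 h2
    · exact h.vertex_inj i h1 j h2 hij
    · exact absurd hij (hne i h1)
    · exact absurd hij.symm (hne j h2)
    · omega
  edge_inj i hi j hj hij := by
    split_ifs at hij with h1 h2 h2
    · exact h.edge_inj i h1 j h2 hij
    · exact absurd hij (hne' i h1)
    · exact absurd hij.symm (hne' j h2)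
    · omega

theorem IsPathSeq.take {p q : ℕ} {v : ℕ → α} {e : ℕ → Set α} (h : IsPathSeq G p v e)
    (hq : q ≤ p) : IsPathSeq G q v e where
  mem_vertexSet i hi := h.mem_vertexSet i (by omega)
  mem_edgeSet i hi := h.mem_edgeSet i (by omega)
  left_mem i hi := h.left_mem i (by omega)
  right_mem i hi := h.right_mem i (by omega)
  vertex_inj i hi j hj := h.vertex_inj i (by omega) j (by omega)
  edge_inj i hi j hj := h.edge_inj i (by omega) j (by omega)

/-- A finite acyclic hypergraph with at least one edge has an edge all of whose vertices, except
possibly one, lie in no other edge. -/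
theorem exists_pendant_edge
    (hG : ∀ (p : ℕ) (v : Fin (p + 1) → α) (e : Fin p → Set α), ¬ G.IsCycle p v e)
    (hfin : G.vertexSet.Finite) (hE : ∀ e ∈ G.edgeSet, e.Nontrivial) (hne : G.edgeSet.Nonempty) :
    ∃ e ∈ G.edgeSet, ∃ v ∈ e, ∀ z ∈ e, z ≠ v → ∀ e' ∈ G.edgeSet, z ∈ e' → e' = e := by
  -- A longest path is taken; the index is shifted by one so that a last edge `e P` exists. The
  -- exceptional vertex of that edge is `v P`, where the path enters it.
  let S : Set ℕ := {p | ∃ v e, IsPathSeq G (p + 1) v e}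
  have hS : S.Nonempty := by
    obtain ⟨e, he⟩ := hne
    obtain ⟨a, ha, b, hb, hab⟩ := hE e he
    have h0 : IsPathSeq G 0 (fun _ => a) (fun _ => e) :=
      ⟨fun _ _ => mem_vertexSet_of_mem_edgeSet he ha, by simp, by simp, by simp,
        fun i hi j hj _ => by omega, by simp⟩
    exact ⟨0, _, _, h0.extend he ha hb (fun _ _ => hab) (by simp)⟩
  have hbdd : BddAbove S := by
    refine ⟨G.vertexSet.ncard, ?_⟩
    rintro p ⟨v, e, h⟩
    have h1 := Set.ncard_le_ncard (s := v '' (range (p + 1) : Set ℕ)) (t := G.vertexSet)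
      (by
        rintro _ ⟨i, hi, rfl⟩
        exact h.mem_vertexSet i (by have := mem_range.1 (mem_coe.1 hi); omega)) hfin
    rw [Set.InjOn.ncard_image, Set.ncard_coe_finset, card_range] at h1
    · omega
    · intro i hi j hj
      simp only [coe_range, Set.mem_Iio] at hi hj
      exact h.vertex_inj i (by omega) j (by omega)
  obtain ⟨v, e, h⟩ := Nat.sSup_mem hS hbdd
  set P := sSup S with hP
  refine ⟨e P, h.mem_edgeSet P (by omega), v P, h.left_mem P (by omega),
    fun z hz hzv e' he' hze' => ?_⟩
  have hz' : ∀ i ≤ P, v i ≠ z := by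
    rintro i hi rfl
    have hiP : i < P := lt_of_le_of_ne hi fun h' => hzv (by rw [h'])
    obtain ⟨l, hl, hl', hle⟩ := (h.take (Nat.le_succ P)).exists_edge_eq hG hiP le_rfl
      (h.mem_edgeSet P (by omega)) hz (h.left_mem P (by omega))
    have := h.edge_inj l (by omega) P (by omega) hle
    omega
  -- Every other vertex `z` of the last edge may serve as the end of the path.
  have h' := h.update_last hz hz'
  set v' : ℕ → α := fun i => if i ≤ P then v i else z with hv'
  have hv'z : v' (P + 1) = z := by simp [hv']
  by_contra hne'
  have hnew : ∀ i < P + 1, e i ≠ e' := by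
    rintro i hi rfl
    have hiP : i < P := by
      refine lt_of_le_of_ne (by omega) fun h' => hne' (by rw [h'])
    obtain ⟨l, hl, hl', hle⟩ := h'.exists_edge_eq hG (i := i + 1) (j := P + 1) (by omega) le_rfl he'
      (h'.right_mem i hi) (by rwa [hv'z])
    have := h.edge_inj l (by omega) i (by omega) hle
    omega
  -- A second edge `e'` through `z` is off the path, so its further vertex `y` either lies on the
  -- path, contradicting acyclicity, or lengthens a longest path.
  obtain ⟨y, hy, hyz⟩ := (hE e' he').exists_ne z
  by_cases hyv : ∃ i ≤ P + 1, v' i = y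
  · obtain ⟨i, hi, rfl⟩ := hyv
    have hiP : i < P + 1 := lt_of_le_of_ne hi fun h' => hyz (by rw [h', hv'z])
    obtain ⟨l, hl, hl', hle⟩ := h'.exists_edge_eq hG hiP le_rfl he' hy (by rwa [hv'z])
    exact hnew l hl' hle
  · push Not at hyv
    have := le_csSup hbdd (show P + 1 ∈ S from
      ⟨_, _, h'.extend he' (by rwa [hv'z]) hy hyv hnew⟩)
    omega

/-- Connectivity survives because a path between old vertices avoids the leaves: an inner vertex of
a path lies in two different edges, a leaf in only one. -/
theorem IsHypertree.of_isPendant {v : α} {L : Finset α} (h : G.IsHypertree)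
    (hP : IsPendant G₁ G v L) : G₁.IsHypertree := by
  have hE : G₁.edgeSet ⊆ G.edgeSet := by
    rw [hP.edgeSet_eq]
    exact Set.subset_insert _ _
  have hV : G₁.vertexSet ⊆ G.vertexSet := by
    rw [hP.vertexSet_eq]
    exact Set.subset_union_left
  have hleaf : ∀ z ∈ L, ∀ e ∈ G.edgeSet, z ∈ e → e = insert v ↑L := by
    intro z hz e he hze
    rw [hP.edgeSet_eq] at he
    rcases he with rfl | he
    · rfl
    · exact absurd (mem_vertexSet_of_mem_edgeSet he hze) (hP.notMem z hz)
  refine ⟨⟨v, hP.mem⟩, fun u hu w hw => ?_, fun p w e hc => h.acyclic p w e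
    ⟨⟨fun i => hV (hc.isWalk.mem_vertexSet i), fun i => hE (hc.isWalk.mem_edgeSet i),
      hc.isWalk.left_mem, hc.isWalk.right_mem, hc.isWalk.ne⟩, hc.two_le, hc.edge_injective,
      hc.vertex_injective, hc.closed⟩⟩
  obtain ⟨p, hp⟩ := h.connected u (hV hu) w (hV hw)
  obtain ⟨s, e, hs, rfl, rfl⟩ := hp.exists_seq
  have hsL : ∀ i ≤ p, s i ∉ L := by
    intro i hi hiL
    have hi0 : i ≠ 0 := by
      rintro rfl
      exact hP.notMem _ hiL hu
    have hip : i ≠ p := by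
      rintro rfl
      exact hP.notMem _ hiL hw
    obtain ⟨i, rfl⟩ := Nat.exists_eq_succ_of_ne_zero hi0
    have h1 := hleaf _ hiL (e i) (hs.mem_edgeSet i (by omega)) (hs.right_mem i (by omega))
    have h2 := hleaf _ hiL (e (i + 1)) (hs.mem_edgeSet _ (by omega)) (hs.left_mem _ (by omega))
    have := hs.edge_inj i (by omega) (i + 1) (by omega) (h1.trans h2.symm)
    omega
  refine ⟨p, _, _, IsPathSeq.isPath (v := s) (e := e) ⟨fun i hi => ?_, fun i hi => ?_, hs.left_mem,
    hs.right_mem, hs.vertex_inj, hs.edge_inj⟩, by simp, by simp⟩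
  · have := hs.mem_vertexSet i hi
    rw [hP.vertexSet_eq] at this
    exact this.resolve_right (hsL i hi)
  · have := hs.mem_edgeSet i hi
    rw [hP.edgeSet_eq] at this
    refine this.resolve_left fun heq => ?_
    have h1 := hs.left_mem i hi
    have h2 := hs.right_mem i hi
    rw [heq] at h1 h2
    have h1 := h1.resolve_right (hsL i (by omega))
    have h2 := h2.resolve_right (hsL (i + 1) (by omega))
    have := hs.vertex_inj i (by omega) (i + 1) (by omega) (h1.trans h2.symm)
    omega

/-- Pendant edges are peeled off, by strong induction on the number of vertices; without edges,
connectivity leaves a single vertex. -/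
theorem IsHypertree.exists_isBuilt {K : ℕ} (hK : 1 ≤ K) (h : G.IsHypertree)
    (hfin : G.vertexSet.Finite) (hu : G.IsUniform (K + 1)) : ∃ m, IsBuilt K m G := by
  classical
  obtain ⟨N, hN⟩ : ∃ N, G.vertexSet.ncard = N := ⟨_, rfl⟩
  induction N using Nat.strong_induction_on generalizing G with
  | _ N ih =>
  rcases G.edgeSet.eq_empty_or_nonempty with hE | hE
  · obtain ⟨v, hv⟩ := h.nonempty
    refine ⟨0, .single G v (Set.Subset.antisymm (fun w hw => ?_) (by simpa using hv)) hE⟩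
    obtain ⟨p, hp⟩ := h.connected v hv w hw
    obtain ⟨s, e, hs, rfl, rfl⟩ := hp.exists_seq
    rcases Nat.eq_zero_or_pos p with rfl | hp
    · rfl
    · have := hs.mem_edgeSet 0 hp
      rw [hE] at this
      exact absurd this (Set.notMem_empty _)
  · have hnt : ∀ e ∈ G.edgeSet, e.Nontrivial := by
      intro e he
      have := (hfin.subset (subset_vertexSet_of_mem_edgeSet he)).to_subtype
      refine Set.one_lt_ncard_iff_nontrivial.1 ?_
      rw [hu e he]
      omega
    obtain ⟨e, he, v, hve, hleaf⟩ := exists_pendant_edge h.acyclic hfin hnt hE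
    have heV := subset_vertexSet_of_mem_edgeSet he
    have hefin := hfin.subset heV
    let L : Finset α := (hefin.subset (Set.sdiff_subset (t := {v}))).toFinset
    have hL : (L : Set α) = e \ {v} := Set.Finite.coe_toFinset _
    have hmem : ∀ z, z ∈ L ↔ z ∈ e ∧ z ≠ v := fun z => by
      rw [← mem_coe, hL]
      rfl
    have hins : insert v (L : Set α) = e := by
      rw [hL, Set.insert_sdiff_singleton, Set.insert_eq_of_mem hve]
    have hcard : L.card = K := by
      rw [← Set.ncard_coe_finset, hL, Set.ncard_sdiff_singleton_of_mem hve, hu e he]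
      omega
    have hLne : L.Nonempty := card_pos.1 (by omega)
    let G₁ : Hypergraph α := ⟨G.vertexSet \ L, G.edgeSet \ {e}, by
      rintro e' ⟨he', hne⟩ z hz
      refine ⟨subset_vertexSet_of_mem_edgeSet he' hz, fun hzL => hne ?_⟩
      have := (hmem z).1 hzL
      exact hleaf z this.1 this.2 e' he' hz⟩
    have hP : IsPendant G₁ G v L := by
      refine ⟨⟨heV hve, fun hv => ((hmem v).1 hv).2 rfl⟩, fun u hu hu' => hu'.2 hu, ?_, ?_⟩
      · refine (Set.sdiff_union_of_subset ?_).symm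
        rw [hL]
        exact Set.sdiff_subset.trans heV
      · rw [hins]
        exact (Set.insert_sdiff_singleton.trans (Set.insert_eq_of_mem he)).symm
    have hlt : G₁.vertexSet.ncard < G.vertexSet.ncard := by
      refine Set.ncard_lt_ncard ⟨Set.sdiff_subset, fun hsub => ?_⟩ hfin
      obtain ⟨z, hz⟩ := hLne
      exact (hsub (heV ((hmem z).1 hz).1)).2 hz
    obtain ⟨m, hm⟩ := ih _ (hN ▸ hlt) (h.of_isPendant hP) (hfin.subset Set.sdiff_subset)
      (fun e' he' => hu e' he'.1) rfl
    exact ⟨m + 1, .pendant m G₁ G v L hm hP hcard⟩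

/-- Each vertex of a cycle lies in two different edges of it, so a cycle contains no leaf. It cannot
use the new edge either, since two distinct non-leaves would have to lie there. -/
theorem IsPendant.acyclic {v : α} {L : Finset α} (hP : IsPendant G₁ G v L)
    (h : ∀ (p : ℕ) (v : Fin (p + 1) → α) (e : Fin p → Set α), ¬ G₁.IsCycle p v e)
    (p : ℕ) (s : Fin (p + 1) → α) (e : Fin p → Set α) : ¬ G.IsCycle p s e := by
  intro hc
  have h2 := hc.two_le
  have hleaf : ∀ z ∈ L, ∀ e ∈ G.edgeSet, z ∈ e → e = insert v ↑L := by
    intro z hz e he hze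
    rw [hP.edgeSet_eq] at he
    rcases he with rfl | he
    · rfl
    · exact absurd (mem_vertexSet_of_mem_edgeSet he hze) (hP.notMem z hz)
  have key : ∀ i j : Fin p, i ≠ j → ∀ z ∈ e i, z ∈ e j → z ∉ L := by
    intro i j hij z hi hj hz
    exact hij (hc.edge_injective ((hleaf z hz _ (hc.isWalk.mem_edgeSet i) hi).trans
      (hleaf z hz _ (hc.isWalk.mem_edgeSet j) hj).symm))
  have h0 : s 0 ∉ L := by
    refine key ⟨0, by omega⟩ ⟨p - 1, by omega⟩ (by simp; omega) _
      (hc.isWalk.left_mem ⟨0, by omega⟩) ?_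
    rw [hc.closed]
    have := hc.isWalk.right_mem ⟨p - 1, by omega⟩
    convert this using 2
    ext
    simp
    omega
  have hsL : ∀ i, s i ∉ L := by
    intro i
    rcases Nat.eq_zero_or_pos (i : ℕ) with hi0 | hi0
    · rwa [show i = 0 from Fin.ext hi0]
    rcases eq_or_lt_of_le (Nat.lt_succ_iff.1 i.2) with hip | hip
    · rwa [show i = Fin.last p from Fin.ext hip, ← hc.closed]
    · refine key ⟨i - 1, by omega⟩ ⟨i, hip⟩ (by simp; omega) _ ?_ (hc.isWalk.left_mem ⟨i, hip⟩)
      have := hc.isWalk.right_mem ⟨i - 1, by omega⟩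
      convert this using 2
      ext
      simp
      omega
  refine h p s e ⟨⟨fun i => ?_, fun i => ?_, hc.isWalk.left_mem, hc.isWalk.right_mem, hc.isWalk.ne⟩,
    hc.two_le, hc.edge_injective, hc.vertex_injective, hc.closed⟩
  · have := hc.isWalk.mem_vertexSet i
    rw [hP.vertexSet_eq] at this
    exact this.resolve_right (hsL i)
  · have := hc.isWalk.mem_edgeSet i
    rw [hP.edgeSet_eq] at this
    refine this.resolve_left fun heq => hc.isWalk.ne i ?_
    have h1 := hc.isWalk.left_mem i
    have h2 := hc.isWalk.right_mem i
    rw [heq] at h1 h2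
    exact (h1.resolve_right (hsL _)).trans (h2.resolve_right (hsL _)).symm

theorem IsBuilt.isHypertree {K m : ℕ} (h : IsBuilt K m G) : G.IsHypertree := by
  have hd := h.isDistFun
  refine ⟨?_, fun u hu w hw => ⟨_, hd.hasPath hu hw⟩, ?_⟩
  · cases h with
    | single G v hV hE => exact ⟨v, by simp [hV]⟩
    | pendant m G₁ G v L h₁ hP hL => exact ⟨v, by rw [hP.vertexSet_eq]; exact Or.inl hP.mem⟩
  · clear hd
    induction h with
    | single G v hV hE =>
      intro p s e hc
      have := hc.isWalk.mem_edgeSet ⟨0, by have := hc.two_le; omega⟩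
      rw [hE] at this
      exact this
    | pendant m G₁ G v L h₁ hP hL ih => exact hP.acyclic ih

theorem IsBuilt.isUniform {K m : ℕ} (h : IsBuilt K m G) : G.IsUniform (K + 1) := by
  induction h with
  | single G v hV hE => simp [IsUniform, hE]
  | pendant m G₁ G v L h₁ hP hL ih =>
    intro e he
    rw [hP.edgeSet_eq] at he
    rcases he with rfl | he
    · rw [Set.ncard_insert_of_notMem (fun hv => hP.notMem v hv hP.mem), Set.ncard_coe_finset, hL]
    · exact ih e he

end

/-! ### The loose path and isomorphisms -/

section
variable {α β : Type*} {K m : ℕ} {G : Hypergraph α} {H : Hypergraph β} {f : ℕ → α} {g : ℕ → β}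

theorem isPathLabel_loosePath {n k : ℕ} (hk : 2 ≤ k) (hn : n = m * (k - 1) + 1) :
    ∃ g, IsPathLabel (k - 1) m (loosePath n k) g := by
  have hm : (n - 1) / (k - 1) = m := by
    rw [hn, Nat.add_sub_cancel, Nat.mul_div_cancel _ (by omega)]
  have hg : ∀ p (hp : p < n),
      (if h : p < n then (⟨p, h⟩ : Fin n) else ⟨0, by omega⟩) = ⟨p, hp⟩ := fun p hp => dif_pos hp
  refine ⟨fun p => if h : p < n then ⟨p, h⟩ else ⟨0, by omega⟩,
    ⟨fun _ _ => Set.mem_univ _, fun p hp q hq hpq => ?_, fun j _ => ⟨j, ?_, ?_⟩⟩, fun e => ?_⟩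
  · simp only [coe_range, Set.mem_Iio] at hp hq
    rw [← hn] at hp hq
    simpa [hp, hq] using hpq
  · simp only [coe_range, Set.mem_Iio]
    omega
  · simp
  · have key : ∀ i < m, {j : Fin n | i * (k - 1) ≤ (j : ℕ) ∧ (j : ℕ) ≤ i * (k - 1) + (k - 1)} =
        (fun p => if h : p < n then (⟨p, h⟩ : Fin n) else ⟨0, by omega⟩) ''
          Set.Icc (i * (k - 1)) (i * (k - 1) + (k - 1)) := by
      intro i hi
      have := block_le (K := k - 1) hi
      ext j
      constructor
      · intro hj
        exact ⟨j, hj, by simp⟩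
      · rintro ⟨p, hp, rfl⟩
        have hpn : p < n := by
          have := hp.2
          omega
        simpa [hpn] using hp
    simp only [loosePath, hm]
    constructor
    · rintro ⟨i, hi, rfl⟩
      exact ⟨i, hi, key i hi⟩
    · rintro ⟨i, hi, rfl⟩
      exact ⟨i, hi, (key i hi).symm⟩

theorem image_label_equiv {N : ℕ} (hf : Set.MapsTo f (range N) G.vertexSet)
    (φ : G.vertexSet ≃ H.vertexSet)
    (hφ : ∀ p (hp : p ∈ (range N : Set ℕ)), (φ ⟨f p, hf hp⟩ : β) = g p)
    {s : Set G.vertexSet} {I : Set ℕ} (hI : I ⊆ (range N : Set ℕ))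
    (hs : Subtype.val '' s = f '' I) : Subtype.val '' (φ '' s) = g '' I := by
  have hs' : ∀ u, u ∈ s ↔ (u : α) ∈ f '' I := by
    intro u
    rw [← hs]
    simp
  ext w
  constructor
  · rintro ⟨_, ⟨⟨u, hu⟩, hus, rfl⟩, rfl⟩
    obtain ⟨p, hp, rfl⟩ := (hs' _).1 hus
    exact ⟨p, hp, (hφ p (hI hp)).symm⟩
  · rintro ⟨p, hp, rfl⟩
    refine ⟨_, ⟨⟨f p, hf (hI hp)⟩, (hs' _).2 ⟨p, hp, rfl⟩, rfl⟩, hφ p (hI hp)⟩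

theorem block_subset {i : ℕ} (hi : i < m) :
    Set.Icc (i * K) (i * K + K) ⊆ (range (m * K + 1) : Set ℕ) := by
  intro p hp
  have := block_le (K := K) hi
  have := hp.2
  simp only [coe_range, Set.mem_Iio]
  omega

theorem IsPathLabel.isomorphic (h : IsPathLabel K m G f) (h' : IsPathLabel K m H g) :
    G.Isomorphic H := by
  let φ : G.vertexSet ≃ H.vertexSet := (h.bijOn.equiv f).symm.trans (h'.bijOn.equiv g)
  have hφ : ∀ p (hp : p ∈ (range (m * K + 1) : Set ℕ)), φ ⟨f p, h.bijOn.mapsTo hp⟩ =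
      ⟨g p, h'.bijOn.mapsTo hp⟩ := by
    intro p hp
    have : (h.bijOn.equiv f).symm ⟨f p, h.bijOn.mapsTo hp⟩ = ⟨p, hp⟩ := by
      rw [Equiv.symm_apply_eq]
      rfl
    simp only [φ, Equiv.trans_apply, this]
    rfl
  refine ⟨φ, fun s => ?_⟩
  rw [h.mem_edgeSet, h'.mem_edgeSet]
  constructor
  · rintro ⟨i, hi, hs⟩
    exact ⟨i, hi, image_label_equiv h.bijOn.mapsTo φ (fun p hp => by rw [hφ p hp])
      (block_subset hi) hs⟩
  · rintro ⟨i, hi, hs⟩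
    refine ⟨i, hi, ?_⟩
    have := image_label_equiv h'.bijOn.mapsTo φ.symm (g := f)
      (fun p hp => by rw [← hφ p hp, Equiv.symm_apply_apply]) (block_subset hi) hs
    rwa [Equiv.symm_image_image] at this

theorem IsPathLabel.of_isomorphic (h' : IsPathLabel K m H g) (h : G.Isomorphic H) :
    ∃ f, IsPathLabel K m G f := by
  obtain ⟨φ, hφ⟩ := h
  have h0 : g 0 ∈ H.vertexSet := h'.bijOn.mapsTo (by simp)
  -- The value at `g 0` is only a default for positions outside the path.
  let f : ℕ → α := fun p => by
    classical
    exact if hp : g p ∈ H.vertexSet then φ.symm ⟨g p, hp⟩ else φ.symm ⟨g 0, h0⟩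
  have hf : ∀ p (hp : p ∈ (range (m * K + 1) : Set ℕ)),
      f p = φ.symm ⟨g p, h'.bijOn.mapsTo hp⟩ := fun p hp => dif_pos (h'.bijOn.mapsTo hp)
  have hmaps : Set.MapsTo f (range (m * K + 1)) G.vertexSet := fun p hp => by
    rw [hf p hp]
    exact Subtype.prop _
  refine ⟨f, ⟨hmaps, fun p hp q hq hpq => ?_, fun u hu => ?_⟩, fun e => ?_⟩
  · rw [hf p hp, hf q hq] at hpq
    have := φ.symm.injective (Subtype.ext hpq)
    exact h'.bijOn.injOn hp hq (congrArg Subtype.val this)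
  · obtain ⟨p, hp, hpu⟩ := h'.bijOn.surjOn (φ ⟨u, hu⟩).2
    refine ⟨p, hp, ?_⟩
    rw [hf p hp]
    have : (⟨g p, h'.bijOn.mapsTo hp⟩ : H.vertexSet) = φ ⟨u, hu⟩ := Subtype.ext hpu
    rw [this, Equiv.symm_apply_apply]
  · have key : ∀ i < m, ∀ s : Set G.vertexSet,
        Subtype.val '' s = f '' Set.Icc (i * K) (i * K + K) ↔
          Subtype.val '' (φ '' s) = g '' Set.Icc (i * K) (i * K + K) := by
      intro i hi s
      constructor
      · refine image_label_equiv hmaps φ (fun p hp => ?_) (block_subset hi)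
        have : (⟨f p, hmaps hp⟩ : G.vertexSet) = φ.symm ⟨g p, h'.bijOn.mapsTo hp⟩ :=
          Subtype.ext (hf p hp)
        rw [this, Equiv.apply_symm_apply]
      · intro hs
        have := image_label_equiv h'.bijOn.mapsTo φ.symm (g := f)
          (fun p hp => (hf p hp).symm) (block_subset hi) hs
        rwa [Equiv.symm_image_image] at this
    have hmain : ∀ s : Set G.vertexSet, Subtype.val '' s ∈ G.edgeSet ↔
        ∃ i < m, Subtype.val '' s = f '' Set.Icc (i * K) (i * K + K) := by
      intro s
      rw [hφ, h'.mem_edgeSet]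
      exact exists_congr fun i => and_congr_right fun hi => (key i hi s).symm
    by_cases heV : e ⊆ G.vertexSet
    · have : Subtype.val '' (Subtype.val ⁻¹' e : Set G.vertexSet) = e := by
        rw [Subtype.image_preimage_coe, Set.inter_eq_right.2 heV]
      rw [← this]
      exact hmain _
    · refine ⟨fun he => absurd (subset_vertexSet_of_mem_edgeSet he) heV, ?_⟩
      rintro ⟨i, hi, rfl⟩
      exact absurd ((hmaps.mono_left (block_subset hi)).image_subset) heV

end

/-! ### Rayleigh quotients of the distance matrix -/

section
variable {α : Type*} {G : Hypergraph α} {V : Finset α}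

theorem isHermitian_distMatrix : G.distMatrix.IsHermitian := by
  ext u w
  simp [distMatrix, G.dist_comm u w]

variable [Fintype G.vertexSet]

theorem dotProduct_distMatrix_mulVec (hV : G.vertexSet = ↑V) (x : α → ℝ) :
    (fun u : G.vertexSet => x u) ⬝ᵥ G.distMatrix.mulVec (fun u => x u) = G.weightedDist V x := by
  have hV' : ∀ u, u ∈ V ↔ u ∈ G.vertexSet := fun u => by rw [hV, mem_coe]
  rw [weightedDist, sum_subtype V hV']
  refine sum_congr rfl fun u _ => ?_
  rw [sum_subtype V hV', Matrix.mulVec, dotProduct, mul_sum]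
  refine sum_congr rfl fun w _ => ?_
  simp only [distMatrix, Matrix.of_apply]
  ring

/-- The distance spectral radius bounds the Rayleigh quotients of the distance matrix. -/
theorem weightedDist_le (hne : G.vertexSet.Nonempty) (hV : G.vertexSet = ↑V) (x : α → ℝ) :
    G.weightedDist V x ≤ G.distSpectralRadius * ∑ u ∈ V, x u ^ 2 := by
  classical
  have hV' : ∀ u, u ∈ V ↔ u ∈ G.vertexSet := fun u => by rw [hV, mem_coe]
  set ρ := G.distSpectralRadius with hρ
  have hM : (ρ • (1 : Matrix G.vertexSet G.vertexSet ℝ) - G.distMatrix).IsHermitian :=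
    (Matrix.isHermitian_one.smul (IsSelfAdjoint.all ρ)).sub isHermitian_distMatrix
  -- An eigenvalue `μ` of `ρ • 1 - G.distMatrix` makes `ρ - μ` an eigenvalue of the distance matrix;
  -- it is at most `ρ`, so `μ` is nonnegative.
  have hpos := hM.posSemidef_iff_eigenvalues_nonneg.2 fun i => by
    have h1 := hM.mulVec_eigenvectorBasis i
    rw [Matrix.sub_mulVec, Matrix.smul_mulVec, Matrix.one_mulVec] at h1
    have h2 : Module.End.HasEigenvalue G.distMatrix.mulVecLin (ρ - hM.eigenvalues i) := by
      refine Module.End.hasEigenvalue_of_hasEigenvector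
        (x := (hM.eigenvectorBasis i).ofLp) ⟨?_, ?_⟩
      · rw [Module.End.mem_eigenspace_iff, Matrix.mulVecLin_apply, sub_smul, ← h1]
        abel
      · intro h0
        exact hM.eigenvectorBasis.orthonormal.ne_zero i (by ext j; exact congrFun h0 j)
    have := (G.isGreatest_distSpectralRadius hne).2 h2
    simp only [Pi.zero_apply]
    linarith
  have h3 := hpos.re_dotProduct_nonneg fun u : G.vertexSet => x u
  rw [Matrix.sub_mulVec, Matrix.smul_mulVec, Matrix.one_mulVec] at h3
  simp only [star_trivial, dotProduct_sub, dotProduct_smul, RCLike.re_to_real, smul_eq_mul] at h3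
  rw [dotProduct_distMatrix_mulVec hV] at h3
  have h4 : (fun u : G.vertexSet => x u) ⬝ᵥ (fun u => x u) = ∑ u ∈ V, x u ^ 2 := by
    rw [sum_subtype V hV']
    exact sum_congr rfl fun u _ => (sq _).symm
  rw [h4] at h3
  linarith

/-- The maximal Rayleigh quotient of the distance matrix is attained at a positive vector. -/
theorem exists_pos_weightedDist_eq (hne : G.vertexSet.Nonempty) (hV : G.vertexSet = ↑V)
    (hd : IsDistFun G G.dist) : ∃ x : α → ℝ, (∀ u ∈ G.vertexSet, 0 < x u) ∧
      G.weightedDist V x = G.distSpectralRadius * ∑ u ∈ V, x u ^ 2 := by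
  classical
  have hV' : ∀ u, u ∈ V ↔ u ∈ G.vertexSet := fun u => by rw [hV, mem_coe]
  obtain ⟨y, hy, hy0⟩ := (G.isGreatest_distSpectralRadius hne).1.exists_hasEigenvector
  rw [Module.End.mem_eigenspace_iff, Matrix.mulVecLin_apply] at hy
  set ρ := G.distSpectralRadius with hρ
  let z : α → ℝ := fun u => if h : u ∈ G.vertexSet then y ⟨u, h⟩ else 0
  have hz : (fun u : G.vertexSet => z u) = y := by
    funext u
    simp [z]
  have hWz : G.weightedDist V z = ρ * ∑ u ∈ V, z u ^ 2 := by
    rw [← dotProduct_distMatrix_mulVec hV, hz, hy, dotProduct_smul, smul_eq_mul,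
      sum_subtype V hV', ← hz]
    congr 1
    exact sum_congr rfl fun u _ => (sq _).symm
  -- Distances are nonnegative, so absolute values do not lower the quadratic form and `|z|` is
  -- again extremal.
  have hWx : G.weightedDist V (fun u => |z u|) = ρ * ∑ u ∈ V, |z u| ^ 2 := by
    refine le_antisymm (weightedDist_le hne hV _) ?_
    simp only [sq_abs]
    rw [← hWz]
    refine sum_le_sum fun u _ => sum_le_sum fun w _ => ?_
    refine mul_le_mul_of_nonneg_right ?_ (Nat.cast_nonneg _)
    rw [← abs_mul]
    exact le_abs_self _
  refine ⟨fun u => |z u|, fun v hv => ?_, hWx⟩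
  by_contra hneg
  have hzv : |z v| = 0 := le_antisymm (not_lt.1 hneg) (abs_nonneg _)
  obtain ⟨u, hu⟩ : ∃ u : G.vertexSet, y u ≠ 0 := by
    by_contra! h
    exact hy0 (funext h)
  have hzu : 0 < |z u| := by
    rw [abs_pos]
    simpa [z] using hu
  have hσ : 0 < ∑ u ∈ V, |z u| * (G.dist u v : ℝ) := by
    refine sum_pos' (fun w _ => by positivity) ⟨u, (hV' _).2 u.2, mul_pos hzu ?_⟩
    have huv : (u : α) ≠ v := by
      intro h
      rw [h, hzv] at hzu
      exact lt_irrefl _ hzu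
    obtain ⟨_, -, _, -, -, h⟩ := hd.descent u u.2 v hv huv
    rw [h]
    positivity
  set σ := ∑ u ∈ V, |z u| * (G.dist u v : ℝ) with hσ'
  -- If `|z|` vanished at `v`, raising that entry to `t` would gain `2 * t * σ` in the form but only
  -- `ρ * t ^ 2` in the Rayleigh bound. This is impossible for small positive `t`, and `t = σ / (|ρ|
  -- + 1)` is small enough.
  have key : ∀ t : ℝ, 2 * t * σ ≤ ρ * t ^ 2 := by
    intro t
    have h1 := weightedDist_le hne hV (Function.update (fun u => |z u|) v (|z v| + t))
    have h2 := weightedDist_update ((hV' v).2 hv) (hd.self v hv) (fun u => |z u|) t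
    have h3 : ∑ u ∈ V, Function.update (fun u => |z u|) v (|z v| + t) u ^ 2 =
        ∑ u ∈ V, |z u| ^ 2 + t ^ 2 := by
      rw [← add_sum_erase _ _ ((hV' v).2 hv), ← add_sum_erase _ (fun u => |z u| ^ 2) ((hV' v).2 hv),
        Function.update_self, sum_congr rfl (g := fun u => |z u| ^ 2), hzv]
      · ring
      · intro u hu
        rw [Function.update_of_ne (ne_of_mem_erase hu)]
    rw [h3] at h1
    rw [h2, hWx] at h1
    linarith
  have ht : 0 < σ / (|ρ| + 1) := by positivity
  have h1 := key (σ / (|ρ| + 1))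
  have h2 : ρ * (σ / (|ρ| + 1)) ≤ σ := by
    rw [mul_div_assoc', div_le_iff₀ (by positivity)]
    nlinarith [le_abs_self ρ]
  nlinarith [mul_le_mul_of_nonneg_right h2 ht.le, mul_pos ht hσ]

end

/-! ### Comparison of spectral radii and conclusion -/

theorem IsBuilt.distSpectralRadius_le {α β : Type*} {K m : ℕ} {G : Hypergraph α} {H : Hypergraph β}
    [Fintype G.vertexSet] [Fintype H.vertexSet] {g : ℕ → β} (hK : 1 ≤ K) (h : IsBuilt K m G)
    (hg : IsPathLabel K m H g) : G.distSpectralRadius ≤ H.distSpectralRadius ∧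
      ((∃ f, IsPathLabel K m G f) ∨ G.distSpectralRadius < H.distSpectralRadius) := by
  classical
  have hV : G.vertexSet = ↑G.vertexSet.toFinset := (Set.coe_toFinset _).symm
  have hU : H.vertexSet = ↑H.vertexSet.toFinset := (Set.coe_toFinset _).symm
  obtain ⟨x, hx, hρ⟩ := exists_pos_weightedDist_eq h.isHypertree.nonempty hV h.isDistFun
  obtain ⟨f, hf, hle, hor⟩ := h.exists_label hK hV hx
  have hH := hg.isBuilt hK
  have : Nonempty β := ⟨g 0⟩
  -- The extremal weights of `G` are transported to the loose path `H` along the labellings `f` and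
  -- `g`. Total and square sum are preserved, so the comparison of costs becomes a reversed
  -- comparison of distance sums.
  let y : β → ℝ := fun w => x (f (Function.invFunOn g (range (m * K + 1)) w))
  have hy : ∀ p < m * K + 1, y (g p) = x (f p) := by
    intro p hp
    simp only [y]
    rw [hg.bijOn.injOn.leftInvOn_invFunOn (by simpa using hp)]
  have hcost : H.treeCost m H.vertexSet.toFinset y = pathCost K m (x ∘ f) := by
    rw [hg.treeCost_eq hK hU]
    exact pathCost_congr hy
  have hS : ∑ w ∈ H.vertexSet.toFinset, y w = ∑ u ∈ G.vertexSet.toFinset, x u := by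
    rw [sum_label hU hg.bijOn, sum_label hV hf]
    exact sum_congr rfl fun p hp => hy p (mem_range.1 hp)
  have hQ : ∑ w ∈ H.vertexSet.toFinset, y w ^ 2 = ∑ u ∈ G.vertexSet.toFinset, x u ^ 2 := by
    rw [sum_label hU hg.bijOn (fun w => y w ^ 2), sum_label hV hf (fun u => x u ^ 2)]
    exact sum_congr rfl fun p hp => by rw [hy p (mem_range.1 hp)]
  have hpos : 0 < ∑ u ∈ G.vertexSet.toFinset, x u ^ 2 := by
    obtain ⟨v, hv⟩ := h.isHypertree.nonempty
    exact sum_pos (fun u hu => pow_pos (hx u (Set.mem_toFinset.1 hu)) 2)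
      ⟨v, Set.mem_toFinset.2 hv⟩
  have hW := weightedDist_le hH.isHypertree.nonempty hU y
  rw [hQ] at hW
  rw [← hcost] at hle hor
  unfold treeCost at hle hor
  rw [hS, hQ, hρ] at hle hor
  exact ⟨le_of_mul_le_mul_right (by linarith) hpos,
    hor.imp id fun hlt => lt_of_mul_lt_mul_right (by linarith) hpos.le⟩

end Hypergraph


theorem theorem4p2 {α : Type*} (n k : ℕ) (hk : 2 ≤ k) (hkn : k ≤ n)
    (T : Hypergraph α) [Fintype T.vertexSet] (hn : Fintype.card T.vertexSet = n)
    (hT : T.IsHypertree) (hTk : T.IsUniform k) :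
    ((Hypergraph.loosePath n k).IsHypertree ∧ (Hypergraph.loosePath n k).IsUniform k) ∧
    T.distSpectralRadius ≤ (Hypergraph.loosePath n k).distSpectralRadius ∧
    (T.distSpectralRadius = (Hypergraph.loosePath n k).distSpectralRadius ↔
      T.Isomorphic (Hypergraph.loosePath n k)) := by
  classical
  have hK : 1 ≤ k - 1 := by omega
  have hk1 : k - 1 + 1 = k := by omega
  obtain ⟨m, hm⟩ := hT.exists_isBuilt hK (Set.toFinite _) (by rwa [hk1])
  have hcard : n = m * (k - 1) + 1 := by
    -- The weights 1 are arbitrary here: only the bijection from `m * (k - 1) + 1` positions to the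
    -- vertices is used, to count them.
    obtain ⟨f, hf, -⟩ := hm.exists_label hK (Set.coe_toFinset _).symm (x := fun _ => 1)
      fun _ _ => one_pos
    have := Finset.card_image_of_injOn hf.injOn
    rw [Finset.card_range] at this
    rw [← hn, ← this, ← Set.toFinset_card]
    congr 1
    ext u
    rw [Set.mem_toFinset, ← hf.image_eq, Finset.mem_image]
    simp
  obtain ⟨g, hg⟩ := Hypergraph.isPathLabel_loosePath hk hcard
  have hP := hg.isBuilt hK
  have hmain := hm.distSpectralRadius_le hK hg
  refine ⟨⟨hP.isHypertree, hk1 ▸ hP.isUniform⟩, hmain.1, fun heq => ?_, fun hiso => ?_⟩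
  · obtain ⟨f, hf⟩ := hmain.2.resolve_right heq.not_lt
    exact hf.isomorphic hg
  · obtain ⟨f, hf⟩ := hg.of_isomorphic hiso
    -- Now `T` is a loose path as well, so the comparison applies with the roles exchanged.
    exact le_antisymm hmain.1 (hP.distSpectralRadius_le hK hf).1
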